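/- Let $d,p\ge 1$, $\Theta=[\theta_{\inf},\theta_{\sup}]^p$, and let $\theta_0$ satisfy $\theta_{\inf}<(\theta_0)_i<\theta_{\sup}$ for all $i$. Let $\{K_\theta,\theta\in\Theta\}$ be stationary covariance functions on $\mathbb{R}^d$ such that: * for every $t\in\mathbb{R}^d$, $\theta\mapsto K_\theta(t)$ is three times differentiable on $\Theta$, and for all $q\in\{0,\dots,3\}$ and $i_1,\dots,i_q\in\{1,\dots,p\}$ there is a finite constant $C_{i_1,\dots,i_q}$ with $\left|\frac{\partial}{\partial\theta_{i_1}}\cdots\frac{\partial}{\partial\theta_{i_q}}K_\theta(t)\right|\le \frac{C_{i_1,\dots,i_q}}{1+|t|^{d+1}}$ for all $\theta\in\Theta$, $t\in\mathbb{R}^d$, where $|\cdot|$ is the Euclidean norm; * with $\hat K_\theta(f)=(2\pi)^{-d}\int_{\mathbb{R}^d}K_\theta(t)e^{-\mathrm{i}f\cdot t}\,dt$, the function $\hat K_\theta$ is integrable and $K_\theta(t)=\int_{\mathbb{R}^d}\hat K_\theta(f)e^{\mathrm{i}f\cdot t}\,df$ for all $\theta\in\Theta$ and $t\in\mathbb{R}^d$,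 and $(f,\theta)\mapsto\hat K_\theta(f)$ is real-valued, continuous and positive on $\mathbb{R}^d\times\Theta$. Let $(v_i)_{i\ge1}$ be a sequence of points of $\{1,2,\dots\}^d$ with $\{v_i:1\le i\le N^d\}=\{1,\dots,N\}^d$ for every $N\ge1$, let $\epsilon\in[0,\frac12)$, and let $X_1,X_2,\dots$ be independent random vectors with common law $\mathcal{L}_X$, a symmetric probability distribution on $\mathbb{R}^d$ whose topological support $S_X$ is contained in $[-1,1]^d$ and which has a density with respect to Lebesgue measure that is positive on $S_X$. Let $R_\theta$ be the $n\times n$ random matrix with entries $(R_\theta)_{a,b}=K_\theta(v_a-v_b+\epsilon(X_a-X_b))$, and let $R=R_{\theta_0}$ and $\frac{\partial R}{\partial\theta_i}=\frac{\partial R_\theta}{\partial\theta_i}\big|_{\theta=\theta_0}$. Let $\Sigma_{ML}$ be the deterministic $p\times p$ matrix whose $(i,j)$ entry is the almost sure limit, as $n\to\infty$, of $$\frac1n\,\mathrm{Tr}\left(\frac12R^{-1}\frac{\partial R}{\partial\theta_i}R^{-1}\frac{\partial R}{\partial\theta_j}\right).$$ 1. Case $\epsilon=0$. If there is no $(\lambda_1,\dots,\lambda_p)\in\mathbb{R}^p\setminus\{0\}$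 such that $\sum_{k=1}^p\lambda_k\frac{\partial}{\partial\theta_k}K_{\theta_0}(v)=0$ for all $v\in\mathbb{Z}^d$, then $\Sigma_{ML}$ exists and is positive definite. 2. Case $\epsilon\ne0$. Let $C_{S_X}=\{t_1-t_2:t_1,t_2\in S_X\}$ and $D_\epsilon=\bigcup_{v\in\mathbb{Z}^d\setminus\{0\}}(v+\epsilon C_{S_X})$. If there is no $(\lambda_1,\dots,\lambda_p)\in\mathbb{R}^p\setminus\{0\}$ such that both $\sum_{k=1}^p\lambda_k\frac{\partial}{\partial\theta_k}K_{\theta_0}(t)=0$ for Lebesgue-almost every $t\in D_\epsilon$ and $\sum_{k=1}^p\lambda_k\frac{\partial}{\partial\theta_k}K_{\theta_0}(0)=0$, then $\Sigma_{ML}$ exists and is positive definite. -/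

import Mathlib

namespace PerturbedGrid

open MeasureTheory

noncomputable section

/-- The parameter set `Θ = [a, b]^p`. -/
def paramBox (p : ℕ) (a b : ℝ) : Set (Fin p → ℝ) :=
  Set.Icc (fun _ => a) (fun _ => b)

/-- The partial derivative `∂F/∂θ_i`, taken within `Θ` (so it is one-sided on the faces of the
box, and the usual partial derivative at interior points). -/
def partialWithin {p : ℕ} (Θ : Set (Fin p → ℝ)) (i : Fin p) (F : (Fin p → ℝ) → ℝ) :
    (Fin p → ℝ) → ℝ :=
  fun θ => lineDerivWithin ℝ F Θ θ (Pi.single i 1)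

/-- The iterated partial derivative `∂/∂θ_{i_1} ⋯ ∂/∂θ_{i_q} F` for the list `[i_1, …, i_q]`. -/
def iterPartialWithin {p : ℕ} (Θ : Set (Fin p → ℝ)) (I : List (Fin p))
    (F : (Fin p → ℝ) → ℝ) : (Fin p → ℝ) → ℝ :=
  I.foldr (partialWithin Θ) F

/-- The Fourier transform `(2π)^{-d} ∫ h(t) e^{-i f·t} dt`. -/
def fourierHat {d : ℕ} (h : EuclideanSpace ℝ (Fin d) → ℝ) (f : EuclideanSpace ℝ (Fin d)) : ℂ :=
  (1 / (2 * (Real.pi : ℂ)) ^ d) *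
    ∫ t : EuclideanSpace ℝ (Fin d), (h t : ℂ) * Complex.exp (-(Complex.I * (inner ℝ f t : ℝ)))

/-- `(s, t) ↦ k (s - t)` is a (stationary) covariance function on `ℝ^d`: it is symmetric and
positive semidefinite. -/
structure IsStationaryCovariance {d : ℕ} (k : EuclideanSpace ℝ (Fin d) → ℝ) : Prop where
  symm : ∀ t, k (-t) = k t
  nonneg : ∀ (m : ℕ) (x : Fin m → EuclideanSpace ℝ (Fin d)) (c : Fin m → ℝ),
    0 ≤ ∑ i, ∑ j, c i * c j * k (x i - x j)

/-- The standing condition on the parametric covariance model `{K_θ, θ ∈ Θ}`. Nothing is required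
of `K θ` for `θ ∉ Θ`. -/
structure IsRegularModel {d p : ℕ} (Θ : Set (Fin p → ℝ))
    (K : (Fin p → ℝ) → EuclideanSpace ℝ (Fin d) → ℝ) : Prop where
  /-- each `K_θ` is a stationary covariance function -/
  covariance : ∀ θ ∈ Θ, IsStationaryCovariance (K θ)
  /-- `θ ↦ K_θ(t)` is three times differentiable on `Θ`: its partial derivatives of order at most
  two are differentiable -/
  differentiable : ∀ I : List (Fin p), I.length ≤ 2 → ∀ t,
    DifferentiableOn ℝ (iterPartialWithin Θ I (fun θ => K θ t)) Θ
  /-- decay of all partial derivatives of order at most three, uniformly in `θ` -/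
  decay : ∀ I : List (Fin p), I.length ≤ 3 → ∃ C : ℝ, ∀ θ ∈ Θ, ∀ t,
    |iterPartialWithin Θ I (fun θ => K θ t) θ| ≤ C / (1 + ‖t‖ ^ (d + 1))
  /-- Fourier inversion -/
  integrable_hat : ∀ θ ∈ Θ, Integrable (fourierHat (K θ))
  inversion : ∀ θ ∈ Θ, ∀ t, (K θ t : ℂ) =
    ∫ f : EuclideanSpace ℝ (Fin d), fourierHat (K θ) f * Complex.exp (Complex.I * (inner ℝ f t : ℝ))
  /-- the Fourier transform is jointly continuous in `(f, θ)` -/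
  continuous_hat : ContinuousOn
    (fun z : EuclideanSpace ℝ (Fin d) × (Fin p → ℝ) => fourierHat (K z.2) z.1) (Set.univ ×ˢ Θ)
  /-- the Fourier transform is real and positive -/
  hat_real : ∀ θ ∈ Θ, ∀ f, (fourierHat (K θ) f).im = 0
  hat_pos : ∀ θ ∈ Θ, ∀ f, 0 < (fourierHat (K θ) f).re

/-- `v_1, v_2, …` (indexed from `0` here) enumerates the positive integer grid through the growing
cubes: `{v_i, 1 ≤ i ≤ N^d} = {1, …, N}^d` for every `N ≥ 1`. -/
def IsGridEnumeration {d : ℕ} (v : ℕ → Fin d → ℤ) : Prop :=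
  ∀ N : ℕ, 1 ≤ N → v '' {i | i < N ^ d} = {w | ∀ k, 1 ≤ w k ∧ w k ≤ (N : ℤ)}

/-- The assumptions on the law `L_X` of the perturbations: a symmetric probability distribution
with support `S_X ⊆ [-1,1]^d` and a probability density that is positive on `S_X`. -/
structure IsPerturbationLaw {d : ℕ} (L : Measure (EuclideanSpace ℝ (Fin d))) : Prop where
  prob : IsProbabilityMeasure L
  symm : L.map (fun x => -x) = L
  support_subset : ∀ x ∈ L.support, ∀ k, -1 ≤ x k ∧ x k ≤ 1
  density : ∃ g : EuclideanSpace ℝ (Fin d) → ℝ, Measurable g ∧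
    L = volume.withDensity (fun x => ENNReal.ofReal (g x)) ∧ ∀ x ∈ L.support, 0 < g x

/-- An integer vector as a point of `ℝ^d`. -/
def latticePoint {d : ℕ} (w : Fin d → ℤ) : EuclideanSpace ℝ (Fin d) :=
  WithLp.toLp 2 (fun k => (w k : ℝ))

/-- The `n × n` matrix `(R_θ)_{ij} = K_θ(v_i - v_j + ε (x_i - x_j))`. -/
def covMatrix {d p : ℕ} (K : (Fin p → ℝ) → EuclideanSpace ℝ (Fin d) → ℝ) (v : ℕ → Fin d → ℤ)
    (ε : ℝ) (x : ℕ → EuclideanSpace ℝ (Fin d)) (n : ℕ) (θ : Fin p → ℝ) :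
    Matrix (Fin n) (Fin n) ℝ :=
  Matrix.of fun i j => K θ (latticePoint (v i) - latticePoint (v j) + ε • (x i - x j))

/-- The entrywise partial derivative `∂R_θ/∂θ_i`. -/
def covMatrixDeriv {d p : ℕ} (Θ : Set (Fin p → ℝ))
    (K : (Fin p → ℝ) → EuclideanSpace ℝ (Fin d) → ℝ) (v : ℕ → Fin d → ℤ)
    (ε : ℝ) (x : ℕ → EuclideanSpace ℝ (Fin d)) (n : ℕ) (θ : Fin p → ℝ) (i : Fin p) :
    Matrix (Fin n) (Fin n) ℝ :=
  Matrix.of fun a b => partialWithin Θ i (fun θ' => covMatrix K v ε x n θ' a b) θ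

/-- `M_ML^{i,j} = ½ R⁻¹ (∂R/∂θ_i) R⁻¹ (∂R/∂θ_j)`, at the parameter `θ`. -/
def matrixML {d p : ℕ} (Θ : Set (Fin p → ℝ))
    (K : (Fin p → ℝ) → EuclideanSpace ℝ (Fin d) → ℝ) (v : ℕ → Fin d → ℤ)
    (ε : ℝ) (x : ℕ → EuclideanSpace ℝ (Fin d)) (n : ℕ) (θ : Fin p → ℝ) (i j : Fin p) :
    Matrix (Fin n) (Fin n) ℝ :=
  (1 / 2 : ℝ) • ((covMatrix K v ε x n θ)⁻¹ * covMatrixDeriv Θ K v ε x n θ i *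
    (covMatrix K v ε x n θ)⁻¹ * covMatrixDeriv Θ K v ε x n θ j)

/-- `S` is the matrix `Σ_ML`: each entry `S i j` is the almost sure limit of
`(1/n) Tr (M_ML^{i,j})`. There is at most one such matrix. -/
def IsSigmaML {d p : ℕ} (Θ : Set (Fin p → ℝ))
    (K : (Fin p → ℝ) → EuclideanSpace ℝ (Fin d) → ℝ) (v : ℕ → Fin d → ℤ) (ε : ℝ)
    {Ω : Type*} [MeasurableSpace Ω] (P : Measure Ω) (X : ℕ → Ω → EuclideanSpace ℝ (Fin d))
    (θ₀ : Fin p → ℝ) (S : Matrix (Fin p) (Fin p) ℝ) : Prop :=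
  ∀ i j, ∀ᵐ ω ∂P, Filter.Tendsto
    (fun n : ℕ => (1 / (n : ℝ)) * (matrixML Θ K v ε (fun m => X m ω) n θ₀ i j).trace)
    Filter.atTop (nhds (S i j))

/-- `D_ε = ⋃_{v ∈ ℤ^d \ {0}} (v + ε C_S)`, where `C_S = {t₁ - t₂ : t₁, t₂ ∈ S}`. -/
def lagSet {d : ℕ} (S : Set (EuclideanSpace ℝ (Fin d))) (ε : ℝ) :
    Set (EuclideanSpace ℝ (Fin d)) :=
  {t | ∃ w : Fin d → ℤ, w ≠ 0 ∧ ∃ t₁ ∈ S, ∃ t₂ ∈ S, t = latticePoint w + ε • (t₁ - t₂)}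

/-- The directional derivative `∑_k λ_k ∂K_θ/∂θ_k (t)`. -/
def dirDeriv {d p : ℕ} (Θ : Set (Fin p → ℝ))
    (K : (Fin p → ℝ) → EuclideanSpace ℝ (Fin d) → ℝ) (θ : Fin p → ℝ) (lam : Fin p → ℝ)
    (t : EuclideanSpace ℝ (Fin d)) : ℝ :=
  ∑ k, lam k * partialWithin Θ k (fun θ' => K θ' t) θ

end

end PerturbedGrid

/-! ### Euclidean norms, the Schur test and coercive matrices. -/

namespace PerturbedGrid

/-! Existence of the limit is a law of large numbers for a quantity that is almost local. Two
uniform bounds, in `n` and in all perturbations with values in the cube, make this work. First,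
since `ε < 1/2` keeps the points separated and the spectral density is continuous and positive, `R`
has all eigenvalues above a fixed `c > 0` (`exists_isCoercive_gridMatrix`). Second, the decay of
order `d + 1` dominates `R` and its derivatives by a summable convolution kernel on the lattice, so
the Schur test bounds their norms.

No pointwise decay of `R⁻¹` is needed. A matrix dominated by a summable kernel almost commutes with
a cut-off that varies on a large scale `ρ`, and with coercivity this shows that `R⁻¹ e_i` has little
mass far from site `i`. Hence the `i`-th diagonal entry of `R⁻¹ A R⁻¹ B` is, up to an error that
vanishes as `ρ` grows, a fixed bounded function of the perturbations in the cube of radius `ρ` about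
site `i` (`abs_inv_mul_mul_inv_mul_sub_le`). Such functions are independent at sites whose cubes do
not meet, so their averages converge almost surely to a constant (`ae_tendsto_average_pattern`), and
boundary sites are negligible. The constants form a Cauchy sequence in `ρ`, and their limit is that
of the normalised trace (`exists_ae_tendsto_trace`).

For positive definiteness, the quadratic form of the limit at `lam` is the limit of half the
normalised trace of `R⁻¹ A R⁻¹ A`, with `A` the symmetric matrix of the directional derivative. That
trace is at least a constant times the squared Hilbert–Schmidt norm of `A`
(`le_trace_inv_mul_mul_inv_mul`). If the derivative, which is continuous in the lag, is nonzero at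
one lag reachable by points of the support, the law of large numbers keeps this squared norm above a
positive multiple of `n` (`exists_ae_eventually_le_sum_sq`). The hypotheses of both cases provide
such a lag. -/

/-- The Euclidean norm of a finite real vector. -/
noncomputable def l2norm {ι : Type*} [Fintype ι] (x : ι → ℝ) : ℝ := Real.sqrt (∑ i, x i ^ 2)

section L2

variable {ι κ : Type*} [Fintype ι] [Fintype κ]

lemma l2norm_eq_norm (x : ι → ℝ) : l2norm x = ‖WithLp.toLp 2 x‖ := by
  simp [l2norm, EuclideanSpace.norm_eq]

lemma l2norm_nonneg (x : ι → ℝ) : 0 ≤ l2norm x := Real.sqrt_nonneg _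

lemma l2norm_sq (x : ι → ℝ) : l2norm x ^ 2 = ∑ i, x i ^ 2 :=
  Real.sq_sqrt (Finset.sum_nonneg fun _ _ => sq_nonneg _)

lemma dotProduct_self_eq (x : ι → ℝ) : x ⬝ᵥ x = l2norm x ^ 2 := by
  rw [l2norm_sq, dotProduct]; exact Finset.sum_congr rfl fun i _ => (sq _).symm

lemma l2norm_add_le (x y : ι → ℝ) : l2norm (x + y) ≤ l2norm x + l2norm y := by
  simp only [l2norm_eq_norm, WithLp.toLp_add]; exact norm_add_le _ _

lemma l2norm_sub_le (x y : ι → ℝ) : l2norm (x - y) ≤ l2norm x + l2norm y := by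
  simp only [l2norm_eq_norm, WithLp.toLp_sub]; exact norm_sub_le _ _

lemma abs_dotProduct_le (x y : ι → ℝ) : |x ⬝ᵥ y| ≤ l2norm x * l2norm y := by
  have h := abs_real_inner_le_norm (WithLp.toLp 2 y) (WithLp.toLp 2 x)
  simp only [EuclideanSpace.inner_toLp_toLp, star_trivial, ← l2norm_eq_norm] at h
  rwa [mul_comm] at h

lemma l2norm_le_of_sq_le {x : ι → ℝ} {a : ℝ} (ha : 0 ≤ a) (h : ∑ i, x i ^ 2 ≤ a ^ 2) :
    l2norm x ≤ a := Real.sqrt_le_iff.2 ⟨ha, h⟩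

lemma l2norm_le_of_abs_le {x y : ι → ℝ} (h : ∀ i, |x i| ≤ |y i|) : l2norm x ≤ l2norm y :=
  Real.sqrt_le_sqrt (Finset.sum_le_sum fun i _ => sq_le_sq.2 (h i))

lemma l2norm_comp_le {e : κ → ι} (he : e.Injective) (x : ι → ℝ) : l2norm (x ∘ e) ≤ l2norm x := by
  classical
  refine Real.sqrt_le_sqrt ?_
  simp only [Function.comp]
  rw [← Finset.sum_image (f := fun i => x i ^ 2) (s := Finset.univ) (g := e) he.injOn]
  exact Finset.sum_le_sum_of_subset_of_nonneg (Finset.subset_univ _) fun _ _ _ => sq_nonneg _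

lemma l2norm_single [DecidableEq ι] (i : ι) : l2norm (Pi.single i (1 : ℝ)) = 1 := by
  simp [l2norm, Pi.single_apply]

/-- The Schur test, for a matrix bounded by one with bounded row and column sums. -/
lemma l2norm_mulVec_le_of_sum_le {M B : Matrix ι ι ℝ} {W : ℝ} (hW : 0 ≤ W)
    (hM : ∀ i j, |M i j| ≤ B i j) (hr : ∀ i, ∑ j, B i j ≤ W) (hc : ∀ j, ∑ i, B i j ≤ W)
    (x : ι → ℝ) : l2norm (M.mulVec x) ≤ W * l2norm x := by
  have hB : ∀ i j, 0 ≤ B i j := fun i j => (abs_nonneg _).trans (hM i j)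
  refine l2norm_le_of_sq_le (mul_nonneg hW (l2norm_nonneg _)) ?_
  have key : ∀ i, (M.mulVec x i) ^ 2 ≤ W * ∑ j, B i j * x j ^ 2 := by
    intro i
    -- Splitting `B` into two square roots lets Cauchy–Schwarz use the row sum here and leaves the
    -- column sum for the outer summation.
    have h1 : |M.mulVec x i| ≤ ∑ j, Real.sqrt (B i j) * (Real.sqrt (B i j) * |x j|) := by
      refine (Finset.abs_sum_le_sum_abs _ _).trans (Finset.sum_le_sum fun j _ => ?_)
      rw [abs_mul, ← mul_assoc, Real.mul_self_sqrt (hB i j)]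
      exact mul_le_mul_of_nonneg_right (hM i j) (abs_nonneg _)
    have h2 := Finset.sum_mul_sq_le_sq_mul_sq Finset.univ (fun j => Real.sqrt (B i j))
      (fun j => Real.sqrt (B i j) * |x j|)
    have h3 : (M.mulVec x i) ^ 2 ≤ (∑ j, Real.sqrt (B i j) * (Real.sqrt (B i j) * |x j|)) ^ 2 := by
      rw [← sq_abs]; exact pow_le_pow_left₀ (abs_nonneg _) h1 2
    simp only [mul_pow, sq_abs, Real.sq_sqrt (hB i _)] at h2
    refine (h3.trans h2).trans ?_
    exact mul_le_mul_of_nonneg_right (hr i)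
      (Finset.sum_nonneg fun j _ => mul_nonneg (hB i j) (sq_nonneg _))
  calc ∑ i, (M.mulVec x i) ^ 2 ≤ ∑ i, W * ∑ j, B i j * x j ^ 2 := Finset.sum_le_sum fun i _ => key i
    _ = W * ∑ j, (∑ i, B i j) * x j ^ 2 := by
        rw [← Finset.mul_sum, Finset.sum_comm]; simp_rw [Finset.sum_mul]
    _ ≤ W * ∑ j, W * x j ^ 2 := by
        refine mul_le_mul_of_nonneg_left (Finset.sum_le_sum fun j _ => ?_) hW
        exact mul_le_mul_of_nonneg_right (hc j) (sq_nonneg _)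
    _ = (W * l2norm x) ^ 2 := by rw [← Finset.mul_sum, mul_pow, l2norm_sq]; ring

end L2

section Kernel

variable {G : Type*} [AddCommGroup G] {ι : Type*} [Fintype ι]

/-- The Schur test for a matrix dominated by a summable convolution kernel. -/
lemma l2norm_mulVec_le_tsum {m : G → ℝ} (hm0 : ∀ w, 0 ≤ m w) (hm : Summable m)
    {u : ι → G} (hu : u.Injective) {M : Matrix ι ι ℝ} (hM : ∀ i j, |M i j| ≤ m (u i - u j))
    (x : ι → ℝ) : l2norm (M.mulVec x) ≤ (∑' w, m w) * l2norm x := by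
  classical
  have aux : ∀ f : ι → G, f.Injective → ∑ j, m (f j) ≤ ∑' w, m w := fun f hf => by
    rw [← Finset.sum_image (f := m) (s := Finset.univ) (g := f) hf.injOn]
    exact hm.sum_le_tsum _ fun _ _ => hm0 _
  exact l2norm_mulVec_le_of_sum_le (B := Matrix.of fun i j => m (u i - u j)) (tsum_nonneg hm0) hM
    (fun i => aux _ fun a b h => hu (sub_right_injective h))
    (fun j => aux _ fun a b h => hu (sub_left_injective h)) x

end Kernel

section Coercive

variable {ι κ : Type*} [Fintype ι] [Fintype κ]

/-- `R` is symmetric with all eigenvalues at least `c`. -/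
structure IsCoercive (c : ℝ) (R : Matrix ι ι ℝ) : Prop where
  symm : R.transpose = R
  le : ∀ x, c * l2norm x ^ 2 ≤ x ⬝ᵥ R.mulVec x

variable {c : ℝ} {R : Matrix ι ι ℝ}

lemma IsCoercive.le_l2norm (h : IsCoercive c R) (x : ι → ℝ) :
    c * l2norm x ≤ l2norm (R.mulVec x) := by
  rcases (l2norm_nonneg x).eq_or_lt with h0 | h0
  · rw [← h0, mul_zero]; exact l2norm_nonneg _
  · have := (h.le x).trans ((le_abs_self _).trans (abs_dotProduct_le _ _))
    rw [sq, ← mul_assoc, mul_comm (l2norm x)] at this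
    exact le_of_mul_le_mul_right this h0

variable [DecidableEq ι] [DecidableEq κ]

omit [DecidableEq ι] in
lemma l2norm_eq_zero {x : ι → ℝ} (h : l2norm x = 0) : x = 0 := by
  rw [l2norm_eq_norm, norm_eq_zero] at h
  simpa using congrArg WithLp.ofLp h

lemma IsCoercive.isUnit_det (hc : 0 < c) (h : IsCoercive c R) : IsUnit R.det := by
  rw [← Matrix.isUnit_iff_isUnit_det, ← Matrix.mulVec_injective_iff_isUnit]
  intro x y hxy
  have h1 := h.le_l2norm (x - y)
  rw [Matrix.mulVec_sub, show R.mulVec x = R.mulVec y from hxy, sub_self] at h1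
  have h2 : l2norm (0 : ι → ℝ) = 0 := by simp [l2norm]
  rw [h2] at h1
  have h3 : l2norm (x - y) = 0 :=
    le_antisymm (by nlinarith [l2norm_nonneg (x - y)]) (l2norm_nonneg _)
  exact sub_eq_zero.1 (l2norm_eq_zero h3)

lemma IsCoercive.mulVec_inv (hc : 0 < c) (h : IsCoercive c R) (x : ι → ℝ) :
    R.mulVec (R⁻¹.mulVec x) = x := by
  rw [Matrix.mulVec_mulVec, Matrix.mul_nonsing_inv _ (h.isUnit_det hc), Matrix.one_mulVec]

lemma IsCoercive.l2norm_inv_le (hc : 0 < c) (h : IsCoercive c R) (x : ι → ℝ) :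
    l2norm (R⁻¹.mulVec x) ≤ c⁻¹ * l2norm x := by
  have := h.le_l2norm (R⁻¹.mulVec x)
  rw [h.mulVec_inv hc] at this
  rwa [inv_mul_eq_div, le_div_iff₀' hc]

lemma IsCoercive.inv_transpose (h : IsCoercive c R) : (R⁻¹).transpose = R⁻¹ := by
  rw [Matrix.transpose_nonsing_inv, h.symm]

omit [DecidableEq ι] [DecidableEq κ] in
-- Extension by zero along `e` preserves both the norm and the quadratic form.
lemma IsCoercive.submatrix {e : κ → ι} (he : e.Injective) (h : IsCoercive c R) :
    IsCoercive c (R.submatrix e e) := by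
  refine ⟨by rw [Matrix.transpose_submatrix, h.symm], fun x => ?_⟩
  set y : ι → ℝ := Function.extend e x 0
  have hy : y ∘ e = x := by funext k; exact he.extend_apply _ _ _
  have hy0 : ∀ i, i ∉ Set.range e → y i = 0 := fun i hi => by
    simp [y, Function.extend_apply' _ _ _ (fun h => hi h)]
  have hs : ∀ f : ι → ℝ, (∀ i, i ∉ Set.range e → f i = 0) → ∑ i, f i = ∑ k, f (e k) := by
    intro f hf
    exact (Fintype.sum_of_injective e he _ _ hf fun _ => rfl).symm
  have h1 := h.le y
  have h2 : l2norm y ^ 2 = l2norm x ^ 2 := by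
    rw [l2norm_sq, l2norm_sq, hs _ fun i hi => by rw [hy0 i hi]; simp]
    simp [← hy]
  have h3 : y ⬝ᵥ R.mulVec y = x ⬝ᵥ (R.submatrix e e).mulVec x := by
    simp only [dotProduct, Matrix.mulVec, Matrix.submatrix_apply]
    rw [hs _ fun i hi => by rw [hy0 i hi]; simp]
    refine Finset.sum_congr rfl fun k _ => ?_
    rw [hs _ fun i hi => by rw [hy0 i hi]; simp]
    simp [← hy]
  rwa [h2, h3] at h1

end Coercive

end PerturbedGrid

/-! ### Cut-off commutators and locality of diagonal entries. -/

namespace PerturbedGrid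

/-- The cut-off at scale `ρ` about `a`: it vanishes at `a` and equals `1` outside the ball of
radius `ρ`. -/
noncomputable def cutoff {G : Type*} [SeminormedAddCommGroup G] {ι : Type*} (u : ι → G) (a : G)
    (ρ : ℝ) (i : ι) : ℝ := min 1 (‖u i - a‖ / ρ)

/-- The modulus that bounds commutators of a matrix dominated by `m` with the cut-off at
scale `ρ`. -/
noncomputable def commModulus {G : Type*} [SeminormedAddCommGroup G] (m : G → ℝ) (ρ : ℝ) : ℝ :=
  ∑' w, m w * min 1 (‖w‖ / ρ)

section Cutoff

variable {G : Type*} [SeminormedAddCommGroup G] {ι κ : Type*} [Fintype ι] [Fintype κ]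
  {m : G → ℝ} {u : ι → G} {a : G} {ρ c : ℝ}

/-- Dominated convergence, with `m` itself as majorant. -/
lemma tendsto_commModulus (hm0 : ∀ w, 0 ≤ m w) (hm : Summable m) :
    Filter.Tendsto (commModulus m) Filter.atTop (nhds 0) := by
  have h : Filter.Tendsto (fun ρ : ℝ => ∑' w, m w * min 1 (‖w‖ / ρ)) Filter.atTop
      (nhds (∑' _ : G, (0 : ℝ))) := by
    refine tendsto_tsum_of_dominated_convergence hm (fun w => ?_) ?_
    · have h1 : Filter.Tendsto (fun ρ : ℝ => ‖w‖ / ρ) Filter.atTop (nhds 0) :=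
        Filter.Tendsto.div_atTop tendsto_const_nhds Filter.tendsto_id
      have h2 := (tendsto_const_nhds (x := m w)).mul ((tendsto_const_nhds (x := (1 : ℝ))).min h1)
      simpa using h2
    · filter_upwards [Filter.eventually_gt_atTop 0] with ρ hρ w
      have h0 : 0 ≤ min 1 (‖w‖ / ρ) := le_min zero_le_one (by positivity)
      rw [Real.norm_eq_abs, abs_of_nonneg (mul_nonneg (hm0 w) h0)]
      exact mul_le_of_le_one_right (hm0 w) (min_le_left _ _)
  rw [tsum_zero] at h
  exact h

omit [Fintype ι] in
lemma cutoff_nonneg (hρ : 0 < ρ) (i : ι) : 0 ≤ cutoff u a ρ i :=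
  le_min zero_le_one (by positivity)

omit [Fintype ι] in
lemma abs_cutoff_sub_le (hρ : 0 < ρ) (i j : ι) :
    |cutoff u a ρ i - cutoff u a ρ j| ≤ min 1 (‖u i - u j‖ / ρ) := by
  have h0 := cutoff_nonneg (u := u) (a := a) hρ i
  have h0' := cutoff_nonneg (u := u) (a := a) hρ j
  have h1 : cutoff u a ρ i ≤ 1 := min_le_left _ _
  have h1' : cutoff u a ρ j ≤ 1 := min_le_left _ _
  refine le_min (abs_le.2 ⟨by linarith, by linarith⟩) ?_
  refine (abs_min_sub_min_le_max _ _ _ _).trans ?_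
  rw [sub_self, abs_zero, max_eq_right (abs_nonneg _), ← sub_div, abs_div, abs_of_pos hρ]
  refine div_le_div_of_nonneg_right ?_ hρ.le
  have := abs_norm_sub_norm_le (u i - a) (u j - a)
  rwa [sub_sub_sub_cancel_right] at this

variable (hm0 : ∀ w, 0 ≤ m w) (hm : Summable m) (hu : u.Injective) (hρ : 0 < ρ)

include hm0 hm hu hρ in
-- The commutator has entries `(χ i - χ j) * M i j`, and the cut-off `χ` is `1/ρ`-Lipschitz with
-- values in `[0, 1]`. So the Schur test applies with the kernel whose sum is `commModulus m ρ`.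
lemma l2norm_commutator_le {M : Matrix ι ι ℝ} (hM : ∀ i j, |M i j| ≤ m (u i - u j)) (x : ι → ℝ) :
    l2norm (cutoff u a ρ * M.mulVec x - M.mulVec (cutoff u a ρ * x)) ≤
      commModulus m ρ * l2norm x := by
  have h0 : ∀ w : G, 0 ≤ min 1 (‖w‖ / ρ) := fun w => le_min zero_le_one (by positivity)
  have he : cutoff u a ρ * M.mulVec x - M.mulVec (cutoff u a ρ * x) =
      (Matrix.of fun i j => (cutoff u a ρ i - cutoff u a ρ j) * M i j).mulVec x := by
    funext i
    simp only [Pi.sub_apply, Pi.mul_apply, Matrix.mulVec, dotProduct, Finset.mul_sum,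
      Matrix.of_apply, ← Finset.sum_sub_distrib]
    exact Finset.sum_congr rfl fun j _ => by ring
  rw [he]
  refine l2norm_mulVec_le_tsum (m := fun w => m w * min 1 (‖w‖ / ρ))
    (fun w => mul_nonneg (hm0 w) (h0 w)) ?_ hu (fun i j => ?_) x
  · exact hm.of_nonneg_of_le (fun w => mul_nonneg (hm0 w) (h0 w))
      fun w => mul_le_of_le_one_right (hm0 w) (min_le_left _ _)
  · rw [Matrix.of_apply, abs_mul, mul_comm]
    exact mul_le_mul (hM i j) (abs_cutoff_sub_le hρ i j) (abs_nonneg _) (hm0 _)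

include hm0 hm hu hρ in
lemma l2norm_cutoff_mulVec_le {M : Matrix ι ι ℝ} (hM : ∀ i j, |M i j| ≤ m (u i - u j))
    (x : ι → ℝ) : l2norm (cutoff u a ρ * M.mulVec x) ≤
      (∑' w, m w) * l2norm (cutoff u a ρ * x) + commModulus m ρ * l2norm x := by
  have h1 := l2norm_add_le (M.mulVec (cutoff u a ρ * x))
    (cutoff u a ρ * M.mulVec x - M.mulVec (cutoff u a ρ * x))
  rw [add_sub_cancel] at h1
  exact h1.trans (add_le_add (l2norm_mulVec_le_tsum hm0 hm hu hM _)
    (l2norm_commutator_le hm0 hm hu hρ hM x))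

include hm0 hm hu hρ in
-- For `x = R⁻¹ b` one has `R (χ x) = χ b - [χ, R] x`, and coercivity inverts `R`. This takes the
-- place of an off-diagonal decay estimate for `R⁻¹`.
lemma IsCoercive.l2norm_cutoff_inv_le [DecidableEq ι] (hc : 0 < c) {R : Matrix ι ι ℝ}
    (hR : IsCoercive c R) (hM : ∀ i j, |R i j| ≤ m (u i - u j)) (b : ι → ℝ) :
    l2norm (cutoff u a ρ * R⁻¹.mulVec b) ≤
      c⁻¹ * (l2norm (cutoff u a ρ * b) + commModulus m ρ * l2norm (R⁻¹.mulVec b)) := by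
  set x := R⁻¹.mulVec b
  have hx : R.mulVec x = b := hR.mulVec_inv hc b
  have h1 := hR.le_l2norm (cutoff u a ρ * x)
  have h2 := l2norm_sub_le (cutoff u a ρ * R.mulVec x)
    (cutoff u a ρ * R.mulVec x - R.mulVec (cutoff u a ρ * x))
  rw [sub_sub_cancel] at h2
  have h3 := l2norm_commutator_le (a := a) hm0 hm hu hρ hM x
  rw [hx] at h2 h3
  rw [inv_mul_eq_div, le_div_iff₀' hc]
  linarith

end Cutoff

section Restriction

variable {G : Type*} [SeminormedAddCommGroup G] {ι κ : Type*} [Fintype ι] [Fintype κ]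
  {m : G → ℝ} {u : ι → G} {a : G} {ρ c : ℝ} {e : κ → ι}

lemma submatrix_mulVec_comp (he : e.Injective) (M : Matrix ι ι ℝ) (x : ι → ℝ) :
    (M.submatrix e e).mulVec (x ∘ e) = M.mulVec ((Set.range e).indicator x) ∘ e := by
  funext k
  simp only [Matrix.mulVec, dotProduct, Matrix.submatrix_apply, Function.comp]
  refine Fintype.sum_of_injective e he _ _ (fun i hi => ?_) fun k => ?_
  · rw [Set.indicator_of_notMem hi, mul_zero]
  · rw [Set.indicator_of_mem (Set.mem_range_self k)]

lemma dotProduct_comp (he : e.Injective) (x y : ι → ℝ) :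
    (x ∘ e) ⬝ᵥ (y ∘ e) = (Set.range e).indicator x ⬝ᵥ y := by
  simp only [dotProduct, Function.comp]
  refine Fintype.sum_of_injective e he _ _ (fun i hi => ?_) fun k => ?_
  · rw [Set.indicator_of_notMem hi, zero_mul]
  · rw [Set.indicator_of_mem (Set.mem_range_self k)]

lemma l2norm_indicator_le (s : Set ι) (x : ι → ℝ) : l2norm (s.indicator x) ≤ l2norm x :=
  l2norm_le_of_abs_le fun i => by
    simpa only [Real.norm_eq_abs] using norm_indicator_le_norm_self x i

/-- Sites outside the block lie outside the ball, where the cut-off equals one. -/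
lemma l2norm_sub_indicator_le (hρ : 0 < ρ) (hball : ∀ i, ‖u i - a‖ ≤ ρ → i ∈ Set.range e)
    (x : ι → ℝ) : l2norm (x - (Set.range e).indicator x) ≤ l2norm (cutoff u a ρ * x) := by
  refine l2norm_le_of_abs_le fun i => ?_
  by_cases hi : i ∈ Set.range e
  · rw [Pi.sub_apply, Set.indicator_of_mem hi, sub_self, abs_zero]; exact abs_nonneg _
  · have h1 : ρ < ‖u i - a‖ := not_le.1 fun h => hi (hball i h)
    have h2 : cutoff u a ρ i = 1 := min_eq_left ((one_le_div hρ).2 h1.le)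
    rw [Pi.sub_apply, Set.indicator_of_notMem hi, sub_zero, Pi.mul_apply, h2, one_mul]

variable [DecidableEq ι] [DecidableEq κ]

/-- Restricting a coercive system to a block that contains a ball changes its solution by no more
than the mass of the solution away from the centre of the ball. -/
lemma IsCoercive.l2norm_comp_sub_le (hm0 : ∀ w, 0 ≤ m w) (hm : Summable m) (hu : u.Injective)
    (hρ : 0 < ρ) (hc : 0 < c) (he : e.Injective) (hball : ∀ i, ‖u i - a‖ ≤ ρ → i ∈ Set.range e)
    {R : Matrix ι ι ℝ} (hR : IsCoercive c R) (hM : ∀ i j, |R i j| ≤ m (u i - u j)) (b : ι → ℝ) :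
    l2norm ((R⁻¹.mulVec b) ∘ e - (R.submatrix e e)⁻¹.mulVec (b ∘ e)) ≤
      c⁻¹ * ((∑' w, m w) * l2norm (cutoff u a ρ * R⁻¹.mulVec b)) := by
  set x := R⁻¹.mulVec b
  have hx : R.mulVec x = b := hR.mulVec_inv hc b
  have hR' := hR.submatrix he
  have h1 := hR'.le_l2norm (x ∘ e - (R.submatrix e e)⁻¹.mulVec (b ∘ e))
  rw [Matrix.mulVec_sub, hR'.mulVec_inv hc, submatrix_mulVec_comp he] at h1
  -- Since `R x = b`, the residual of the truncated solution in the block system comes only from the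
  -- discarded coordinates.
  have h2 : R.mulVec ((Set.range e).indicator x) ∘ e - b ∘ e =
      -(R.mulVec (x - (Set.range e).indicator x) ∘ e) := by
    rw [Matrix.mulVec_sub, hx]; funext k; simp
  have h3 : ∀ y : κ → ℝ, l2norm (-y) = l2norm y := fun y => by simp [l2norm]
  rw [h2, h3] at h1
  rw [inv_mul_eq_div, le_div_iff₀' hc]
  refine h1.trans ((l2norm_comp_le he _).trans ((l2norm_mulVec_le_tsum hm0 hm hu hM _).trans ?_))
  exact mul_le_mul_of_nonneg_left (l2norm_sub_indicator_le hρ hball x) (tsum_nonneg hm0)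

omit [Fintype κ] [DecidableEq κ] in
-- Symmetry of `R⁻¹` moves the first factor to the left of the pairing, so that only the two
-- solutions `R⁻¹ e_i` and `R⁻¹ B e_i` need to be localised.
lemma inv_mul_mul_inv_mul_apply {R : Matrix ι ι ℝ} (hR : IsCoercive c R)
    (A B : Matrix ι ι ℝ) (i : ι) :
    (R⁻¹ * A * R⁻¹ * B) i i =
      R⁻¹.mulVec (Pi.single i 1) ⬝ᵥ A.mulVec (R⁻¹.mulVec (B.mulVec (Pi.single i 1))) := by
  have h : ∀ (M : Matrix ι ι ℝ), M i i = Pi.single i 1 ⬝ᵥ M.mulVec (Pi.single i 1) := by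
    intro M; simp
  rw [h (R⁻¹ * A * R⁻¹ * B), ← Matrix.mulVec_mulVec, ← Matrix.mulVec_mulVec, ← Matrix.mulVec_mulVec,
    Matrix.dotProduct_mulVec, ← Matrix.mulVec_transpose, hR.inv_transpose]

/-- The diagonal entries of `R⁻¹ A R⁻¹ B` are local: up to a modulus of the radius, they depend
only on a block around the site. -/
theorem abs_inv_mul_mul_inv_mul_sub_le (hm0 : ∀ w, 0 ≤ m w) (hm : Summable m) (hu : u.Injective)
    (hρ : 0 < ρ) (hc : 0 < c) (he : e.Injective) {k : κ}
    (hball : ∀ i, ‖u i - u (e k)‖ ≤ ρ → i ∈ Set.range e)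
    {R A B : Matrix ι ι ℝ} (hR : IsCoercive c R) (hRm : ∀ i j, |R i j| ≤ m (u i - u j))
    (hA : ∀ i j, |A i j| ≤ m (u i - u j)) (hB : ∀ i j, |B i j| ≤ m (u i - u j)) :
    |(R⁻¹ * A * R⁻¹ * B) (e k) (e k) - ((R.submatrix e e)⁻¹ * A.submatrix e e *
      (R.submatrix e e)⁻¹ * B.submatrix e e) k k| ≤
      (∑' w, m w) * (1 + c⁻¹ * (∑' w, m w)) *
        (c⁻¹ * c⁻¹ * (c⁻¹ * ∑' w, m w) + c⁻¹ * (c⁻¹ * (1 + c⁻¹ * ∑' w, m w))) *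
        commModulus m ρ := by
  set W := ∑' w, m w
  have hW : 0 ≤ W := tsum_nonneg hm0
  set ω := commModulus m ρ
  have hω : 0 ≤ ω := tsum_nonneg fun w => mul_nonneg (hm0 w) (le_min zero_le_one (by positivity))
  have hci : 0 < c⁻¹ := inv_pos.2 hc
  have hR' := hR.submatrix he
  rw [inv_mul_mul_inv_mul_apply hR, inv_mul_mul_inv_mul_apply hR']
  set b : ι → ℝ := Pi.single (e k) 1
  have hb : (Pi.single k 1 : κ → ℝ) = b ∘ e := by
    funext k'
    simp [b, Pi.single_apply, he.eq_iff]
  have hbr : (Set.range e).indicator b = b := by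
    funext i
    by_cases hi : i ∈ Set.range e
    · rw [Set.indicator_of_mem hi]
    · rw [Set.indicator_of_notMem hi]
      have : i ≠ e k := fun h => hi ⟨k, h.symm⟩
      simp [b, this]
  have hb1 : l2norm b = 1 := l2norm_single _
  have hbχ : cutoff u (u (e k)) ρ * b = 0 := by
    funext i
    by_cases hi : i = e k
    · subst hi; simp [cutoff]
    · simp [b, hi]
  have hl0 : l2norm (0 : ι → ℝ) = 0 := by simp [l2norm]
  have hb2 : (B.submatrix e e).mulVec (Pi.single k 1) = B.mulVec b ∘ e := by
    rw [hb, submatrix_mulVec_comp he, hbr]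
  rw [hb2, hb]
  -- Unprimed vectors solve the full system, primed ones the block system.
  set f := B.mulVec b
  set x := R⁻¹.mulVec b
  set y := R⁻¹.mulVec f
  set x' := (R.submatrix e e)⁻¹.mulVec (b ∘ e)
  set y' := (R.submatrix e e)⁻¹.mulVec (f ∘ e)
  set χ := cutoff u (u (e k)) ρ
  have hx : l2norm x ≤ c⁻¹ := by
    have := hR.l2norm_inv_le hc b; rwa [hb1, mul_one] at this
  have hx' : l2norm x' ≤ c⁻¹ := by
    have := hR'.l2norm_inv_le hc (b ∘ e)
    rwa [← hb, l2norm_single, mul_one, hb] at this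
  have hf : l2norm f ≤ W := by
    have := l2norm_mulVec_le_tsum hm0 hm hu hB b; rwa [hb1, mul_one] at this
  have hy : l2norm y ≤ c⁻¹ * W :=
    (hR.l2norm_inv_le hc f).trans (mul_le_mul_of_nonneg_left hf hci.le)
  have hfχ : l2norm (χ * f) ≤ ω := by
    have := l2norm_cutoff_mulVec_le (a := u (e k)) hm0 hm hu hρ hB b
    rwa [hbχ, hl0, hb1, mul_zero, zero_add, mul_one] at this
  -- The cut-off kills `b`, which is carried by its centre, so only the commutator term remains.
  have hξ : l2norm (χ * x) ≤ c⁻¹ * c⁻¹ * ω := by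
    have := hR.l2norm_cutoff_inv_le (a := u (e k)) hm0 hm hu hρ hc hRm b
    rw [hbχ, hl0, zero_add] at this
    refine this.trans ?_
    rw [mul_assoc, mul_comm c⁻¹ ω]
    gcongr
  have hυ : l2norm (χ * y) ≤ c⁻¹ * (1 + c⁻¹ * W) * ω := by
    have := hR.l2norm_cutoff_inv_le (a := u (e k)) hm0 hm hu hρ hc hRm f
    refine this.trans ?_
    rw [mul_assoc]
    refine mul_le_mul_of_nonneg_left ?_ hci.le
    have := mul_le_mul_of_nonneg_left hy hω
    linarith
  have hxe := hR.l2norm_comp_sub_le (a := u (e k)) hm0 hm hu hρ hc he hball hRm b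
  have hye := hR.l2norm_comp_sub_le (a := u (e k)) hm0 hm hu hρ hc he hball hRm f
  have hue : (u ∘ e).Injective := hu.comp he
  have hA' : ∀ z : κ → ℝ, l2norm ((A.submatrix e e).mulVec z) ≤ W * l2norm z :=
    l2norm_mulVec_le_tsum hm0 hm hue fun i j => hA _ _
  have hA1 : ∀ z : ι → ℝ, l2norm (A.mulVec z) ≤ W * l2norm z := l2norm_mulVec_le_tsum hm0 hm hu hA
  -- Telescoping: truncate `x`, truncate `y`, then replace each restriction by the block solution.
  -- Every term has one factor of size `O(ω)`.
  have hsplit : x ⬝ᵥ A.mulVec y - x' ⬝ᵥ (A.submatrix e e).mulVec y' =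
      (x - (Set.range e).indicator x) ⬝ᵥ A.mulVec y +
      (Set.range e).indicator x ⬝ᵥ A.mulVec (y - (Set.range e).indicator y) +
      (x ∘ e - x') ⬝ᵥ (A.submatrix e e).mulVec (y ∘ e) +
      x' ⬝ᵥ (A.submatrix e e).mulVec (y ∘ e - y') := by
    have : (x ∘ e) ⬝ᵥ (A.submatrix e e).mulVec (y ∘ e) =
        (Set.range e).indicator x ⬝ᵥ A.mulVec ((Set.range e).indicator y) := by
      rw [submatrix_mulVec_comp he, dotProduct_comp he]
    simp only [Matrix.mulVec_sub, sub_dotProduct, dotProduct_sub, this]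
    ring
  rw [hsplit]
  have t1 : |(x - (Set.range e).indicator x) ⬝ᵥ A.mulVec y| ≤
      (c⁻¹ * c⁻¹ * ω) * (W * (c⁻¹ * W)) := by
    refine (abs_dotProduct_le _ _).trans (mul_le_mul ?_ ?_ (l2norm_nonneg _) (by positivity))
    · exact (l2norm_sub_indicator_le hρ hball x).trans hξ
    · exact (hA1 y).trans (mul_le_mul_of_nonneg_left hy hW)
  have t2 : |(Set.range e).indicator x ⬝ᵥ A.mulVec (y - (Set.range e).indicator y)| ≤
      c⁻¹ * (W * (c⁻¹ * (1 + c⁻¹ * W) * ω)) := by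
    refine (abs_dotProduct_le _ _).trans (mul_le_mul ?_ ?_ (l2norm_nonneg _) hci.le)
    · exact (l2norm_indicator_le _ _).trans hx
    · exact (hA1 _).trans (mul_le_mul_of_nonneg_left
        ((l2norm_sub_indicator_le hρ hball y).trans hυ) hW)
  have t3 : |(x ∘ e - x') ⬝ᵥ (A.submatrix e e).mulVec (y ∘ e)| ≤
      (c⁻¹ * (W * (c⁻¹ * c⁻¹ * ω))) * (W * (c⁻¹ * W)) := by
    refine (abs_dotProduct_le _ _).trans (mul_le_mul ?_ ?_ (l2norm_nonneg _) (by positivity))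
    · refine hxe.trans ?_
      gcongr
    · exact (hA' _).trans (mul_le_mul_of_nonneg_left ((l2norm_comp_le he _).trans hy) hW)
  have t4 : |x' ⬝ᵥ (A.submatrix e e).mulVec (y ∘ e - y')| ≤
      c⁻¹ * (W * (c⁻¹ * (W * (c⁻¹ * (1 + c⁻¹ * W) * ω)))) := by
    refine (abs_dotProduct_le _ _).trans (mul_le_mul hx' ?_ (l2norm_nonneg _) hci.le)
    refine (hA' _).trans (mul_le_mul_of_nonneg_left (hye.trans ?_) hW)
    gcongr
  refine (abs_add_le _ _).trans ((add_le_add ((abs_add_le _ _).trans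
    (add_le_add ((abs_add_le _ _).trans (add_le_add t1 t2)) t3)) t4).trans (le_of_eq ?_))
  ring

omit [Fintype κ] [DecidableEq κ] in
lemma abs_inv_mul_mul_inv_mul_le (hm0 : ∀ w, 0 ≤ m w) (hm : Summable m) (hu : u.Injective)
    (hc : 0 < c) {R A B : Matrix ι ι ℝ} (hR : IsCoercive c R)
    (hA : ∀ i j, |A i j| ≤ m (u i - u j)) (hB : ∀ i j, |B i j| ≤ m (u i - u j)) (i : ι) :
    |(R⁻¹ * A * R⁻¹ * B) i i| ≤ (c⁻¹ * ∑' w, m w) ^ 2 := by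
  have hci : 0 < c⁻¹ := inv_pos.2 hc
  have hW : 0 ≤ ∑' w, m w := tsum_nonneg hm0
  rw [inv_mul_mul_inv_mul_apply hR]
  refine (abs_dotProduct_le _ _).trans ?_
  have h1 := hR.l2norm_inv_le hc (Pi.single i 1)
  have h2 := l2norm_mulVec_le_tsum hm0 hm hu hB (Pi.single i 1)
  rw [l2norm_single, mul_one] at h1 h2
  have h3 := (hR.l2norm_inv_le hc (B.mulVec (Pi.single i 1))).trans
    (mul_le_mul_of_nonneg_left h2 hci.le)
  have h4 := (l2norm_mulVec_le_tsum hm0 hm hu hA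
    (R⁻¹.mulVec (B.mulVec (Pi.single i 1)))).trans (mul_le_mul_of_nonneg_left h3 hW)
  refine (mul_le_mul h1 h4 (l2norm_nonneg _) hci.le).trans (le_of_eq (by ring))

end Restriction

/-! ### A lower bound for the trace. -/

/-- `Tr (R⁻¹ A R⁻¹ A)` controls the Hilbert–Schmidt norm of a symmetric matrix `A`. -/
theorem le_trace_inv_mul_mul_inv_mul {ι : Type*} [Fintype ι] [DecidableEq ι] {c W : ℝ}
    (hc : 0 < c) (hW : 0 < W) {R A : Matrix ι ι ℝ} (hR : IsCoercive c R)
    (hRW : ∀ x, l2norm (R.mulVec x) ≤ W * l2norm x) (hA : A.transpose = A) :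
    (c / W ^ 2) ^ 2 * ∑ i, ∑ j, A i j ^ 2 ≤ (R⁻¹ * A * R⁻¹ * A).trace := by
  set s := c / W ^ 2
  have hs : 0 ≤ s := by positivity
  set S := R⁻¹
  have hS : S.transpose = S := hR.inv_transpose
  -- Coercivity at `S x` gives `c * ‖S x‖ ^ 2`, and `‖x‖ ≤ W * ‖S x‖`; hence the value `c / W ^ 2`.
  have hSle : ∀ x : ι → ℝ, s * (x ⬝ᵥ x) ≤ x ⬝ᵥ S.mulVec x := by
    intro x
    have h1 := hR.le (S.mulVec x)
    have h2 := hRW (S.mulVec x)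
    rw [hR.mulVec_inv hc] at h1 h2
    rw [dotProduct_self_eq, dotProduct_comm x]
    refine le_trans ?_ h1
    rw [div_mul_eq_mul_div, div_le_iff₀ (by positivity)]
    have := pow_le_pow_left₀ (l2norm_nonneg _) h2 2
    rw [mul_pow] at this
    nlinarith
  have hpsd : (S - s • (1 : Matrix ι ι ℝ)).PosSemidef := by
    refine Matrix.PosSemidef.of_dotProduct_mulVec_nonneg ?_ fun x => ?_
    · ext i j
      have := congrFun (congrFun hS i) j
      simp only [Matrix.transpose_apply] at this
      simp [this, Matrix.one_apply, eq_comm]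
    · simp only [star_trivial, Matrix.sub_mulVec, Matrix.smul_mulVec, Matrix.one_mulVec,
        dotProduct_sub, dotProduct_smul, smul_eq_mul]
      linarith [hSle x]
  have hSpsd : S.PosSemidef := by
    refine Matrix.PosSemidef.of_dotProduct_mulVec_nonneg ?_ fun x => ?_
    · ext i j; simpa using congrFun (congrFun hS i) j
    · have h1 := hSle x
      have h2 : 0 ≤ x ⬝ᵥ x := by rw [dotProduct_self_eq]; positivity
      simp only [star_trivial]
      nlinarith
  have htr : ∀ P Q : Matrix ι ι ℝ, P.PosSemidef → Q.PosSemidef → 0 ≤ (P * Q).trace := by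
    intro P Q hP hQ
    obtain ⟨n, v, rfl⟩ := Matrix.posSemidef_iff_eq_sum_vecMulVec.1 hP
    rw [Matrix.sum_mul, Matrix.trace_sum]
    refine Finset.sum_nonneg fun i _ => ?_
    rw [Matrix.vecMulVec_mul, Matrix.trace_vecMulVec, dotProduct_comm, ← Matrix.dotProduct_mulVec]
    exact hQ.dotProduct_mulVec_nonneg (v i)
  have hAh : A.conjTranspose = A := by simpa using hA
  -- The bound `S ≥ s` is used twice: `Tr (S A S A) ≥ s Tr (A S A) = s Tr (S A²) ≥ s² Tr A²`.
  have h1 := htr _ _ hpsd (by simpa only [hAh] using hSpsd.mul_mul_conjTranspose_same A)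
  have h2 := htr _ _ hpsd (by
    simpa only [hAh, Matrix.mul_one] using Matrix.PosSemidef.one.mul_mul_conjTranspose_same A)
  rw [Matrix.sub_mul, Matrix.trace_sub, Matrix.smul_mul, Matrix.trace_smul, Matrix.one_mul,
    smul_eq_mul] at h1 h2
  have h3 : (A * A).trace = ∑ i, ∑ j, A i j ^ 2 := by
    simp only [Matrix.trace, Matrix.diag_apply, Matrix.mul_apply]
    refine Finset.sum_congr rfl fun i _ => Finset.sum_congr rfl fun j _ => ?_
    rw [sq]; congr 1
    exact congrFun (congrFun hA i) j
  have h4 : (A * S * A).trace = (S * (A * A)).trace := by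
    rw [Matrix.trace_mul_cycle, Matrix.trace_mul_comm]
  rw [h4] at h1
  rw [← h3, show S * A * S * A = S * (A * S * A) by simp only [Matrix.mul_assoc]]
  nlinarith

end PerturbedGrid

/-! ### Perturbed lattices, cosine transforms and uniform coercivity. -/

namespace PerturbedGrid

open MeasureTheory

/-- The matrix `k(y_i - y_j)` for the points `y_i = u_i + ε z_i` of a perturbed lattice. -/
noncomputable def gridMatrix {d : ℕ} {ι : Type*} (k : EuclideanSpace ℝ (Fin d) → ℝ) (ε : ℝ)
    (z : ι → EuclideanSpace ℝ (Fin d)) (u : ι → Fin d → ℤ) : Matrix ι ι ℝ :=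
  Matrix.of fun i j => k (latticePoint (u i) - latticePoint (u j) + ε • (z i - z j))

/-- The configurations of perturbations with values in the cube `[-1, 1]^d`. -/
def cubeConfig {α : Type*} (d : ℕ) : Set (α → EuclideanSpace ℝ (Fin d)) :=
  {z | ∀ w k, |z w k| ≤ 1}

/-- The cosine transform of `g`. -/
noncomputable def cosTransform {d : ℕ} (g : EuclideanSpace ℝ (Fin d) → ℝ)
    (t : EuclideanSpace ℝ (Fin d)) : ℝ :=
  ∫ f, g f * Real.cos (inner ℝ f t)

section Lattice

variable {d : ℕ}

/-- Look at a coordinate where the integer vector attains its sup norm: the perturbation moves it by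
at most `2 * ε`, which is at most `2 * ε * ‖w‖` because a nonzero integer vector has norm at least
one. -/
lemma norm_le_norm_lattice_add {ε : ℝ} (hε : 0 ≤ ε) {w : Fin d → ℤ} {x y : EuclideanSpace ℝ (Fin d)}
    (hx : ∀ k, |x k| ≤ 1) (hy : ∀ k, |y k| ≤ 1) :
    (1 - 2 * ε) * ‖w‖ ≤ ‖latticePoint w + ε • (x - y)‖ := by
  by_cases h0 : w = 0
  · rw [h0, norm_zero, mul_zero]; exact norm_nonneg _
  have hd : Nonempty (Fin d) := by
    by_contra hne
    rw [not_nonempty_iff] at hne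
    exact h0 (Subsingleton.elim _ _)
  obtain ⟨k, hk⟩ : ∃ k, ‖w k‖ = ‖w‖ := by
    obtain ⟨k, -, hk⟩ := Finset.exists_max_image Finset.univ (fun k => ‖w k‖)
      Finset.univ_nonempty
    exact ⟨k, le_antisymm (norm_le_pi_norm w k)
      ((pi_norm_le_iff_of_nonneg (norm_nonneg _)).2 fun j => hk j (Finset.mem_univ _))⟩
  have hw1 : 1 ≤ ‖w‖ := by
    obtain ⟨j, hj⟩ : ∃ j, w j ≠ 0 := Function.ne_iff.1 h0
    refine le_trans ?_ (norm_le_pi_norm w j)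
    rw [Int.norm_eq_abs]; exact_mod_cast Int.one_le_abs hj
  have h1 : |(latticePoint w + ε • (x - y)) k| ≤ ‖latticePoint w + ε • (x - y)‖ := by
    simpa using PiLp.norm_apply_le (latticePoint w + ε • (x - y)) k
  refine le_trans ?_ h1
  have h2 : (latticePoint w + ε • (x - y)) k = (w k : ℝ) + ε * (x k - y k) := by
    simp [latticePoint]
  have h3 : ‖w‖ = |(w k : ℝ)| := by rw [← hk, Int.norm_eq_abs]
  have h4 : |ε * (x k - y k)| ≤ 2 * ε := by
    rw [abs_mul, abs_of_nonneg hε]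
    have := abs_sub (x k) (y k)
    nlinarith [hx k, hy k]
  have h5 := abs_sub_abs_le_abs_sub ((w k : ℝ)) (-(ε * (x k - y k)))
  rw [abs_neg, sub_neg_eq_add] at h5
  rw [h2]
  nlinarith

lemma summable_norm_pow_inv (d : ℕ) : Summable fun w : Fin d → ℤ => (‖w‖ ^ (d + 1))⁻¹ := by
  let b := Pi.basisFun ℝ (Fin d)
  let Λ : Submodule ℤ (Fin d → ℝ) := Submodule.span ℤ (Set.range b)
  have hmem : ∀ w : Fin d → ℤ, (fun k => (w k : ℝ)) ∈ Λ := fun w => by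
    refine (b.mem_span_iff_repr_mem ℤ _).2 ?_
    exact fun i => ⟨w i, by simp [b]⟩
  have hr : Module.finrank ℤ Λ = d := by
    rw [ZLattice.rank ℝ]; simp
  have hs := ZLattice.summable_norm_pow_inv Λ (d + 1) (by omega)
  have hi : Function.Injective fun w : Fin d → ℤ => (⟨fun k => (w k : ℝ), hmem w⟩ : Λ) := by
    intro w w' h
    have h1 := congrArg Subtype.val h
    funext k
    have h2 : ((w k : ℤ) : ℝ) = (w' k : ℤ) := congrFun h1 k
    exact_mod_cast h2
  refine (hs.comp_injective hi).congr fun w => ?_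
  have hn : ‖(fun k => (w k : ℝ))‖ = ‖w‖ := by
    simp only [Pi.norm_def]
    congr 2
  simp [hn]

lemma latticePoint_sub (w w' : Fin d → ℤ) :
    latticePoint w - latticePoint w' = latticePoint (w - w') := by
  ext k; simp [latticePoint]

lemma norm_sub_le_norm_gridPoint_sub {ε : ℝ} (hε : 0 ≤ ε) {ι : Type*}
    {z : ι → EuclideanSpace ℝ (Fin d)} (hz : z ∈ cubeConfig d) (u : ι → Fin d → ℤ) (i j : ι) :
    (1 - 2 * ε) * ‖u i - u j‖ ≤
      ‖latticePoint (u i) - latticePoint (u j) + ε • (z i - z j)‖ := by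
  rw [latticePoint_sub]
  exact norm_le_norm_lattice_add hε (hz i) (hz j)

end Lattice

section CosTransform

variable {d : ℕ}

lemma integrable_mul_cos {g : EuclideanSpace ℝ (Fin d) → ℝ} (hg : Integrable g)
    (t : EuclideanSpace ℝ (Fin d)) : Integrable fun f => g f * Real.cos (inner ℝ f t) := by
  refine hg.mul_bdd (c := 1) (Continuous.aestronglyMeasurable (by fun_prop))
    (ae_of_all _ fun f => ?_)
  rw [Real.norm_eq_abs]; exact Real.abs_cos_le_one _

/-- The quadratic form of a cosine transform is monotone. -/
lemma sum_cosTransform_le {g₁ g₂ : EuclideanSpace ℝ (Fin d) → ℝ} (h₁ : Integrable g₁)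
    (h₂ : Integrable g₂) (hle : ∀ f, g₁ f ≤ g₂ f) {ι : Type*} [Fintype ι]
    (y : ι → EuclideanSpace ℝ (Fin d)) (x : ι → ℝ) :
    ∑ i, ∑ j, x i * x j * cosTransform g₁ (y i - y j) ≤
      ∑ i, ∑ j, x i * x j * cosTransform g₂ (y i - y j) := by
  have hI : ∀ (g : EuclideanSpace ℝ (Fin d) → ℝ), Integrable g → ∀ i j : ι,
      Integrable fun f => x i * x j * (g f * Real.cos (inner ℝ f (y i - y j))) :=
    fun g hg i j => (integrable_mul_cos hg _).const_mul _
  have key : ∀ g : EuclideanSpace ℝ (Fin d) → ℝ, Integrable g →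
      ∑ i, ∑ j, x i * x j * cosTransform g (y i - y j) =
        ∫ f, ∑ i, ∑ j, x i * x j * (g f * Real.cos (inner ℝ f (y i - y j))) := by
    intro g hg
    rw [integral_finsetSum _ fun i _ => integrable_finsetSum _ fun j _ => hI g hg i j]
    refine Finset.sum_congr rfl fun i _ => ?_
    rw [integral_finsetSum _ fun j _ => hI g hg i j]
    exact Finset.sum_congr rfl fun j _ => (integral_const_mul _ _).symm
  rw [key _ h₁, key _ h₂]
  refine integral_mono
    (integrable_finsetSum _ fun i _ => integrable_finsetSum _ fun j _ => hI _ h₁ i j)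
    (integrable_finsetSum _ fun i _ => integrable_finsetSum _ fun j _ => hI _ h₂ i j) fun f => ?_
  -- At each frequency the form is `a` times the squared modulus of `∑ x_i exp(i f·y_i)`, hence
  -- monotone in `a`.
  have hsq : ∀ a : ℝ, ∑ i, ∑ j, x i * x j * (a * Real.cos (inner ℝ f (y i - y j))) =
      a * ((∑ i, x i * Real.cos (inner ℝ f (y i))) ^ 2 +
        (∑ i, x i * Real.sin (inner ℝ f (y i))) ^ 2) := by
    intro a
    rw [sq, sq, Finset.sum_mul_sum, Finset.sum_mul_sum, ← Finset.sum_add_distrib, Finset.mul_sum]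
    refine Finset.sum_congr rfl fun i _ => ?_
    rw [← Finset.sum_add_distrib, Finset.mul_sum]
    refine Finset.sum_congr rfl fun j _ => ?_
    rw [inner_sub_right, Real.cos_sub]; ring
  simp only [hsq]
  exact mul_le_mul_of_nonneg_right (hle f) (by positivity)

lemma cosTransform_const_mul (a : ℝ) (g : EuclideanSpace ℝ (Fin d) → ℝ)
    (t : EuclideanSpace ℝ (Fin d)) :
    cosTransform (fun f => a * g f) t = a * cosTransform g t := by
  simp only [cosTransform, mul_assoc]; exact integral_const_mul _ _

/-- Widening the spectral profile by `M` amounts to spreading the lags by `M`; this is how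
off-diagonal entries are made small. -/
lemma cosTransform_comp_smul {M : ℝ} (hM : 0 < M) (g : EuclideanSpace ℝ (Fin d) → ℝ)
    (t : EuclideanSpace ℝ (Fin d)) :
    cosTransform (fun f => g (M⁻¹ • f)) t = M ^ d * cosTransform g (M • t) := by
  have h := Measure.integral_comp_inv_smul volume
    (fun f : EuclideanSpace ℝ (Fin d) => g f * Real.cos (inner ℝ f (M • t))) M
  simp only [finrank_euclideanSpace, Fintype.card_fin, smul_eq_mul, abs_of_pos (pow_pos hM d)] at h
  rw [cosTransform, cosTransform, ← h]
  refine integral_congr_ae (ae_of_all _ fun f => ?_)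
  simp only [inner_smul_left, inner_smul_right, RCLike.conj_to_real]
  rw [← mul_assoc, mul_inv_cancel₀ hM.ne', one_mul]

/-- There is a compactly supported profile whose cosine transform is positive at the origin and
decays fast. -/
lemma exists_bump_cosTransform_decay (d : ℕ) : ∃ h : EuclideanSpace ℝ (Fin d) → ℝ,
    Continuous h ∧ HasCompactSupport h ∧ (∀ f, 0 ≤ h f) ∧ (∀ f, h f ≤ 1) ∧
    0 < cosTransform h 0 ∧ ∃ C, 0 < C ∧ ∀ t, ‖t‖ ^ (d + 1) * |cosTransform h t| ≤ C := by
  let φ : ContDiffBump (0 : EuclideanSpace ℝ (Fin d)) := ⟨1, 2, one_pos, one_lt_two⟩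
  have hφc : Continuous φ := φ.continuous
  have hφi : Integrable φ := hφc.integrable_of_hasCompactSupport φ.hasCompactSupport
  refine ⟨φ, hφc, φ.hasCompactSupport, fun f => φ.nonneg, fun f => φ.le_one, ?_, ?_⟩
  · simp only [cosTransform, inner_zero_right, Real.cos_zero, mul_one]
    exact φ.integral_pos
  · have h1 : HasCompactSupport fun f => (φ f : ℂ) :=
      φ.hasCompactSupport.comp_left (g := fun r : ℝ => (r : ℂ)) Complex.ofReal_zero
    have h2 : ContDiff ℝ (⊤ : ℕ∞) fun f => (φ f : ℂ) :=
      Complex.ofRealCLM.contDiff.comp φ.contDiff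
    -- The bump is a Schwartz function, hence so is its Fourier transform. The real part of the
    -- latter at `t / (2π)` is the cosine transform at `t`.
    let S : SchwartzMap (EuclideanSpace ℝ (Fin d)) ℂ := h1.toSchwartzMap h2
    obtain ⟨C, hC, hdec⟩ := (FourierTransform.fourier S).decay (d + 1) 0
    refine ⟨(2 * Real.pi) ^ (d + 1) * C, by positivity, fun t => ?_⟩
    have h3 := hdec ((2 * Real.pi)⁻¹ • t)
    rw [norm_iteratedFDeriv_zero, norm_smul, mul_pow, norm_inv, Real.norm_eq_abs,
      abs_of_pos Real.two_pi_pos, inv_pow, mul_assoc, inv_mul_le_iff₀ (by positivity)] at h3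
    refine le_trans (mul_le_mul_of_nonneg_left ?_ (by positivity)) h3
    rw [SchwartzMap.fourier_coe, Real.fourier_eq']
    refine le_trans (le_of_eq ?_) (Complex.abs_re_le_norm _)
    congr 1
    have hS : Integrable fun v : EuclideanSpace ℝ (Fin d) =>
        Complex.exp (↑(-2 * Real.pi * inner ℝ v ((2 * Real.pi)⁻¹ • t)) * Complex.I) • S v := by
      refine (S.integrable (μ := volume)).bdd_mul (c := 1)
        (Continuous.aestronglyMeasurable (by fun_prop)) (ae_of_all _ fun v => ?_)
      rw [Complex.norm_exp_ofReal_mul_I]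
    have h5 := integral_re hS
    simp only [RCLike.re_to_complex] at h5
    rw [← h5, cosTransform]
    refine integral_congr_ae (ae_of_all _ fun v => ?_)
    have h6 : -2 * Real.pi * inner ℝ v ((2 * Real.pi)⁻¹ • t) = -(inner ℝ v t) := by
      rw [inner_smul_right]; field_simp
    have h7 : S v = (φ v : ℂ) := rfl
    simp only [h6, h7, smul_eq_mul]
    rw [Complex.re_mul_ofReal, Complex.exp_ofReal_mul_I_re, Real.cos_neg, mul_comm]

end CosTransform

/-- The covariance matrices of a stationary field with continuous positive spectral density on
perturbed lattices are uniformly coercive. -/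
theorem exists_isCoercive_gridMatrix {d : ℕ} {ε : ℝ} (hε₀ : 0 ≤ ε) (hε : ε < 1 / 2)
    {g k : EuclideanSpace ℝ (Fin d) → ℝ} (hg : Integrable g) (hgc : Continuous g)
    (hgp : ∀ f, 0 < g f) (hk : ∀ t, k t = cosTransform g t) :
    ∃ c, 0 < c ∧ ∀ {ι : Type} [Fintype ι] (u : ι → Fin d → ℤ), u.Injective →
      ∀ z ∈ cubeConfig (α := ι) d, IsCoercive c (gridMatrix k ε z u) := by
  obtain ⟨h, hhc, hhs, hh0, hh1, hH0, C, hC, hdec⟩ := exists_bump_cosTransform_decay d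
  set H := cosTransform h
  set S := ∑' w : Fin d → ℤ, (‖w‖ ^ (d + 1))⁻¹
  have hS0 : 0 ≤ S := tsum_nonneg fun w => by positivity
  have hδ : 0 < 1 - 2 * ε := by linarith
  set δ := 1 - 2 * ε
  -- Dilate the bump until the off-diagonal row sums are at most half of the diagonal value `H 0`.
  obtain ⟨M, hM, hMS⟩ : ∃ M : ℝ, 0 < M ∧ C / (M * δ) ^ (d + 1) * S ≤ H 0 / 2 := by
    refine ⟨max 1 (2 * C * S / H 0) / δ, by positivity, ?_⟩
    set m := max 1 (2 * C * S / H 0)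
    rw [div_mul_cancel₀ _ hδ.ne', div_mul_eq_mul_div, div_le_iff₀ (by positivity)]
    have h1 : m ≤ m ^ (d + 1) := le_self_pow₀ (le_max_left _ _) (by omega)
    have h2 : 2 * C * S / H 0 ≤ m := le_max_right _ _
    rw [div_le_iff₀ hH0] at h2
    nlinarith
  -- `b` is the minimum of `g` over the compact support of the dilated bump; it suffices since `h ≤
  -- 1`.
  obtain ⟨b, hb, hbg⟩ : ∃ b, 0 < b ∧ ∀ f, b * h (M⁻¹ • f) ≤ g f := by
    have hcs : HasCompactSupport fun f => h (M⁻¹ • f) := hhs.comp_smul (inv_ne_zero hM.ne')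
    rcases (tsupport fun f => h (M⁻¹ • f)).eq_empty_or_nonempty with he | hne
    · refine ⟨1, one_pos, fun f => ?_⟩
      rw [show h (M⁻¹ • f) = 0 from image_eq_zero_of_notMem_tsupport
        (f := fun f => h (M⁻¹ • f)) (by rw [he]; exact Set.notMem_empty f), mul_zero]
      exact (hgp f).le
    · obtain ⟨f₀, -, hf₀⟩ := hcs.isCompact.exists_isMinOn hne hgc.continuousOn
      refine ⟨g f₀, hgp f₀, fun f => ?_⟩
      by_cases hf : f ∈ tsupport fun f => h (M⁻¹ • f)
      · have h1 : g f₀ ≤ g f := hf₀ hf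
        nlinarith [hh1 (M⁻¹ • f), hh0 (M⁻¹ • f), hgp f₀]
      · rw [show h (M⁻¹ • f) = 0 from image_eq_zero_of_notMem_tsupport
          (f := fun f => h (M⁻¹ • f)) hf, mul_zero]
        exact (hgp f).le
  have hhi : Integrable fun f => h (M⁻¹ • f) :=
    (hhc.integrable_of_hasCompactSupport hhs).comp_smul (inv_ne_zero hM.ne')
  refine ⟨b * M ^ d * (H 0 / 2), by positivity, fun u hu z hz => ⟨?_, fun x => ?_⟩⟩
  · ext i j
    simp only [gridMatrix, Matrix.transpose_apply, Matrix.of_apply, hk, cosTransform]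
    refine integral_congr_ae (ae_of_all _ fun f => ?_)
    simp only
    rw [← Real.cos_neg, ← inner_neg_right]
    congr 3
    simp only [smul_sub]; abel
  classical
  set y : _ → EuclideanSpace ℝ (Fin d) := fun i => latticePoint (u i) + ε • z i
  have hy : ∀ i j, latticePoint (u i) - latticePoint (u j) + ε • (z i - z j) =
      y i - y j := fun i j => by simp only [y, smul_sub]; abel
  have h1 : x ⬝ᵥ (gridMatrix k ε z u).mulVec x =
      ∑ i, ∑ j, x i * x j * cosTransform g (y i - y j) := by
    simp only [dotProduct, Matrix.mulVec, gridMatrix, Matrix.of_apply, Finset.mul_sum, hk, hy]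
    exact Finset.sum_congr rfl fun i _ => Finset.sum_congr rfl fun j _ => by ring
  have h2 := sum_cosTransform_le (hhi.const_mul b) hg hbg y x
  rw [h1]
  refine le_trans ?_ h2
  simp only [cosTransform_const_mul, cosTransform_comp_smul hM]
  -- The off-diagonal part, whose norm the Schur test bounds by half of the diagonal.
  let B : Matrix _ _ ℝ := Matrix.of fun i j => if i = j then 0 else H (M • (y i - y j))
  have hB : ∀ i j, |B i j| ≤ C / (M * δ) ^ (d + 1) * (‖u i - u j‖ ^ (d + 1))⁻¹ := by
    intro i j
    by_cases hij : i = j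
    · simp only [B, Matrix.of_apply, hij, if_true, abs_zero]; positivity
    · have hn : 0 < ‖u i - u j‖ := norm_pos_iff.2 (sub_ne_zero.2 (hu.ne hij))
      have h3 := norm_sub_le_norm_gridPoint_sub hε₀ hz u i j
      rw [hy] at h3
      have h4 : M * δ * ‖u i - u j‖ ≤ ‖M • (y i - y j)‖ := by
        rw [norm_smul, Real.norm_eq_abs, abs_of_pos hM, mul_assoc]
        exact mul_le_mul_of_nonneg_left h3 hM.le
      have h5 := hdec (M • (y i - y j))
      simp only [B, Matrix.of_apply, hij, if_false]
      rw [← div_eq_mul_inv, div_div, ← mul_pow, le_div_iff₀ (by positivity), mul_comm]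
      exact le_trans (mul_le_mul_of_nonneg_right
        (pow_le_pow_left₀ (by positivity) h4 _) (abs_nonneg _)) h5
  have h6 := l2norm_mulVec_le_tsum (fun w => by positivity)
    ((summable_norm_pow_inv d).mul_left (C / (M * δ) ^ (d + 1))) hu hB x
  rw [tsum_mul_left] at h6
  have h7 := (abs_dotProduct_le x (B.mulVec x)).trans
    (mul_le_mul_of_nonneg_left h6 (l2norm_nonneg x))
  have h8 : ∑ i, ∑ j, x i * x j * (b * (M ^ d * H (M • (y i - y j)))) =
      b * M ^ d * (H 0 * l2norm x ^ 2 + x ⬝ᵥ B.mulVec x) := by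
    have h9 : H 0 * l2norm x ^ 2 = ∑ i, ∑ j, x i * x j * (if i = j then H 0 else 0) := by
      simp only [l2norm_sq, mul_ite, mul_zero, Finset.sum_ite_eq, Finset.mem_univ, if_true,
        Finset.mul_sum]
      exact Finset.sum_congr rfl fun i _ => by ring
    rw [h9]
    simp only [dotProduct, Matrix.mulVec, Finset.mul_sum, ← Finset.sum_add_distrib]
    refine Finset.sum_congr rfl fun i _ => Finset.sum_congr rfl fun j _ => ?_
    by_cases hij : i = j
    · subst hij; simp only [B, Matrix.of_apply, sub_self, smul_zero, if_true]; ring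
    · simp only [B, Matrix.of_apply, hij, if_false]; ring
  change _ ≤ ∑ i, ∑ j, x i * x j * (b * (M ^ d * H (M • (y i - y j))))
  rw [h8, mul_assoc (b * M ^ d)]
  refine mul_le_mul_of_nonneg_left ?_ (by positivity)
  have h10 := neg_le_of_abs_le h7
  have h11 : C / (M * δ) ^ (d + 1) * S * l2norm x ^ 2 ≤ H 0 / 2 * l2norm x ^ 2 :=
    mul_le_mul_of_nonneg_right hMS (sq_nonneg _)
  nlinarith

end PerturbedGrid

/-! ### Laws of large numbers. -/

namespace PerturbedGrid

open MeasureTheory ProbabilityTheory Filter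

section LLN

variable {Ω : Type*} [MeasurableSpace Ω] {P : Measure Ω} [IsProbabilityMeasure P]

omit [IsProbabilityMeasure P] in
lemma ae_tendsto_zero_of_summable_integral {Y : ℕ → Ω → ℝ} (hY : ∀ k, Integrable (Y k) P)
    (hY0 : ∀ k ω, 0 ≤ Y k ω) {a : ℕ → ℝ} (ha : Summable a) (hYa : ∀ k, ∫ ω, Y k ω ∂P ≤ a k) :
    ∀ᵐ ω ∂P, Tendsto (fun k => Y k ω) atTop (nhds 0) := by
  have h1 : ∑' k, ∫⁻ ω, ENNReal.ofReal (Y k ω) ∂P ≠ ⊤ := by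
    refine ne_top_of_le_ne_top (ENNReal.ofReal_ne_top (r := ∑' k, a k)) ?_
    rw [ENNReal.ofReal_tsum_of_nonneg
      (fun k => (integral_nonneg (hY0 k)).trans (hYa k)) ha]
    refine ENNReal.tsum_le_tsum fun k => ?_
    rw [← ofReal_integral_eq_lintegral_ofReal (hY k) (ae_of_all _ (hY0 k))]
    exact ENNReal.ofReal_le_ofReal (hYa k)
  rw [← lintegral_tsum fun k => (hY k).aestronglyMeasurable.aemeasurable.ennreal_ofReal] at h1
  have h2 := ae_lt_top' (AEMeasurable.tsum
    fun k => (hY k).aestronglyMeasurable.aemeasurable.ennreal_ofReal) h1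
  filter_upwards [h2] with ω hω
  have h3 := (ENNReal.tendsto_toReal ENNReal.zero_ne_top).comp
    (ENNReal.tendsto_atTop_zero_of_tsum_ne_top hω.ne)
  simpa [Function.comp_def, ENNReal.toReal_ofReal (hY0 _ _)] using h3

/-- Every `n` lies within `2 * k` of the square `k ^ 2` below it, so the sums move by `O(k)` there,
which is negligible against `k ^ 2`. -/
lemma tendsto_average_of_tendsto_sq {s : ℕ → ℝ} {C : ℝ}
    (hs : ∀ n, |s (n + 1) - s n| ≤ C)
    (h : Tendsto (fun k : ℕ => (s (k ^ 2) / (k : ℝ) ^ 2) ^ 2) atTop (nhds 0)) :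
    Tendsto (fun n : ℕ => s n / n) atTop (nhds 0) := by
  have hC : 0 ≤ C := (abs_nonneg _).trans (hs 0)
  have h1 : Tendsto (fun k : ℕ => |s (k ^ 2) / (k : ℝ) ^ 2|) atTop (nhds 0) := by
    have := h.sqrt
    simpa [Real.sqrt_sq_eq_abs] using this
  have h2 : Tendsto (fun k : ℕ => |s (k ^ 2) / (k : ℝ) ^ 2| + C * 3 / (k : ℝ)) atTop (nhds 0) := by
    simpa using h1.add (tendsto_const_div_atTop_nhds_zero_nat (C * 3))
  have hsq : Tendsto Nat.sqrt atTop atTop :=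
    tendsto_atTop_atTop.2 fun b => ⟨b * b, fun a ha => Nat.le_sqrt.2 ha⟩
  have hlip : ∀ m n, m ≤ n → |s n - s m| ≤ C * (n - m : ℝ) := by
    intro m n hmn
    induction n, hmn using Nat.le_induction with
    | base => simp
    | succ n hmn ih =>
      have := abs_add_le (s (n + 1) - s n) (s n - s m)
      rw [sub_add_sub_cancel] at this
      push_cast
      linarith [hs n]
  refine squeeze_zero_norm' ?_ (h2.comp hsq)
  filter_upwards [eventually_ge_atTop 1] with n hn
  set k := Nat.sqrt n
  have hk1 : 1 ≤ k := Nat.le_sqrt.2 (by simpa using hn)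
  have hkn : k ^ 2 ≤ n := by rw [sq]; exact Nat.sqrt_le n
  have hnk : n ≤ k ^ 2 + 2 * k := by
    have := Nat.lt_succ_sqrt n
    simp only [Nat.succ_eq_add_one] at this
    change n < (k + 1) * (k + 1) at this
    nlinarith
  have hkR : (1 : ℝ) ≤ k := by exact_mod_cast hk1
  have hknR : (k : ℝ) ^ 2 ≤ n := by exact_mod_cast hkn
  have hnkR : (n : ℝ) ≤ k ^ 2 + 2 * k := by exact_mod_cast hnk
  have h3 := hlip _ _ hkn
  push_cast at h3
  have h4 : |s n| ≤ |s (k ^ 2)| + C * (2 * k) := by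
    have := abs_add_le (s (k ^ 2)) (s n - s (k ^ 2))
    rw [add_sub_cancel] at this
    nlinarith
  simp only [Function.comp, Real.norm_eq_abs, abs_div, Nat.abs_cast, abs_pow]
  change _ ≤ |s (k ^ 2)| / (k : ℝ) ^ 2 + C * 3 / (k : ℝ)
  have h5 : C * 3 / (k : ℝ) = C * (3 * k) / (k : ℝ) ^ 2 := by field_simp
  rw [h5, ← add_div]
  have h6 : |s n| ≤ |s (k ^ 2)| + C * (3 * k) := by nlinarith
  exact (div_le_div_of_nonneg_left (abs_nonneg _) (by positivity) hknR).trans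
    (div_le_div_of_nonneg_right h6 (by positivity))

/-- A law of large numbers for bounded variables whose sums have linearly growing variance. -/
lemma ae_tendsto_average_zero {U : ℕ → Ω → ℝ} (hU : ∀ i, Measurable (U i)) {C D : ℝ}
    (hC : ∀ i ω, |U i ω| ≤ C)
    (hD : ∀ n : ℕ, ∫ ω, (∑ i ∈ Finset.range n, U i ω) ^ 2 ∂P ≤ D * n) :
    ∀ᵐ ω ∂P, Tendsto (fun n : ℕ => (∑ i ∈ Finset.range n, U i ω) / n) atTop (nhds 0) := by
  have hm : ∀ n, Measurable fun ω => ∑ i ∈ Finset.range n, U i ω :=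
    fun n => Finset.measurable_fun_sum _ fun i _ => hU i
  have hb : ∀ n ω, |∑ i ∈ Finset.range n, U i ω| ≤ n * C := fun n ω =>
    (Finset.abs_sum_le_sum_abs _ _).trans
      ((Finset.sum_le_card_nsmul _ _ _ fun i _ => hC i ω).trans (by simp))
  -- Along the squares the second moments of the averages are at most `D / k ^ 2`, which is
  -- summable.
  have h := ae_tendsto_zero_of_summable_integral (P := P)
    (Y := fun k ω => ((∑ i ∈ Finset.range (k ^ 2), U i ω) / (k : ℝ) ^ 2) ^ 2)
    (a := fun k : ℕ => D * ((k : ℝ) ^ 2)⁻¹) (fun k => ?_) (fun k ω => sq_nonneg _)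
    ((Real.summable_nat_pow_inv.2 one_lt_two).mul_left D) (fun k => ?_)
  · filter_upwards [h] with ω hω
    refine tendsto_average_of_tendsto_sq (C := C) (fun n => ?_) hω
    rw [Finset.sum_range_succ, add_sub_cancel_left]
    exact hC n ω
  · refine Integrable.of_bound ((((hm _).div_const _).pow_const 2).aestronglyMeasurable)
      ((((k ^ 2 : ℕ) : ℝ) * C / (k : ℝ) ^ 2) ^ 2) (ae_of_all _ fun ω => ?_)
    rw [Real.norm_eq_abs, abs_pow, abs_div, abs_of_nonneg (by positivity : (0 : ℝ) ≤ (k : ℝ) ^ 2)]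
    exact pow_le_pow_left₀ (by positivity)
      (div_le_div_of_nonneg_right (hb _ ω) (by positivity)) 2
  · simp only [div_pow]
    rw [integral_div]
    have h1 := hD (k ^ 2)
    rcases Nat.eq_zero_or_pos k with rfl | hk
    · simp
    · have hk' : (0 : ℝ) < k := by exact_mod_cast hk
      rw [div_le_iff₀ (by positivity)]
      refine h1.trans (le_of_eq ?_)
      push_cast
      field_simp

/-- After expanding the square, each row has at most `D` nonzero terms, each at most `C ^ 2`. -/
lemma integral_sq_sum_le {U : ℕ → Ω → ℝ} (hU : ∀ i, Measurable (U i)) {C : ℝ} {D : ℕ}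
    (hC : ∀ i ω, |U i ω| ≤ C) (N : ℕ → Finset ℕ) (hN : ∀ i, (N i).card ≤ D)
    (h0 : ∀ i j, j ∉ N i → ∫ ω, U i ω * U j ω ∂P = 0) (n : ℕ) :
    ∫ ω, (∑ i ∈ Finset.range n, U i ω) ^ 2 ∂P ≤ (D * C ^ 2) * n := by
  have hC0 : 0 ≤ C := by
    obtain ⟨ω⟩ : Nonempty Ω := nonempty_of_isProbabilityMeasure P
    exact (abs_nonneg _).trans (hC 0 ω)
  have hbd : ∀ i j ω, ‖U i ω * U j ω‖ ≤ C ^ 2 := fun i j ω => by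
    rw [norm_mul, sq]
    exact mul_le_mul (hC i ω) (hC j ω) (norm_nonneg _) hC0
  have hint : ∀ i j, Integrable (fun ω => U i ω * U j ω) P := fun i j =>
    Integrable.of_bound ((hU i).mul (hU j)).aestronglyMeasurable (C ^ 2) (ae_of_all _ (hbd i j))
  simp only [sq (∑ i ∈ Finset.range n, U i _), Finset.sum_mul_sum]
  rw [integral_finsetSum _ fun i _ => integrable_finsetSum _ fun j _ => hint i j]
  have hrow : ∀ i, ∫ ω, ∑ j ∈ Finset.range n, U i ω * U j ω ∂P ≤ D * C ^ 2 := by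
    intro i
    rw [integral_finsetSum _ fun j _ => hint i j]
    have h1 : ∀ j ∈ Finset.range n, ∫ ω, U i ω * U j ω ∂P ≤ if j ∈ N i then C ^ 2 else 0 := by
      intro j _
      split_ifs with hj
      · refine (le_abs_self _).trans ?_
        have := norm_integral_le_of_norm_le_const (μ := P) (ae_of_all _ (hbd i j))
        simpa using this
      · exact (h0 i j hj).le
    refine (Finset.sum_le_sum h1).trans ?_
    rw [← Finset.sum_filter, Finset.sum_const, nsmul_eq_mul]
    refine mul_le_mul_of_nonneg_right ?_ (sq_nonneg C)
    have : (Finset.range n).filter (· ∈ N i) ⊆ N i := fun j hj => (Finset.mem_filter.1 hj).2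
    exact_mod_cast (Finset.card_le_card this).trans (hN i)
  refine (Finset.sum_le_sum fun i _ => hrow i).trans (le_of_eq ?_)
  simp; ring

variable {𝓧 : Type*} [MeasurableSpace 𝓧] {L : Measure 𝓧}
  {X : ℕ → Ω → 𝓧} {κ : Type*} [Fintype κ]

omit [IsProbabilityMeasure P] in
lemma map_pattern_eq_pi (hX : iIndepFun X P) (hXm : ∀ i, Measurable (X i))
    (hXL : ∀ i, P.map (X i) = L) {g : κ → ℕ} (hg : g.Injective) :
    P.map (fun ω w => X (g w) ω) = Measure.pi fun _ => L := by
  have := hX.isProbabilityMeasure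
  have h1 := (iIndepFun_iff_map_fun_eq_pi_map fun w => (hXm (g w)).aemeasurable).1
    (hX.precomp hg)
  simpa only [hXL] using h1

omit [IsProbabilityMeasure P] in
lemma indepFun_pattern (hX : iIndepFun X P) (hXm : ∀ i, Measurable (X i))
    {ψ : (κ → 𝓧) → ℝ} (hψ : Measurable ψ) {g g' : κ → ℕ} (hgg : ∀ w w', g w ≠ g' w') :
    IndepFun (fun ω => ψ fun w => X (g w) ω) (fun ω => ψ fun w => X (g' w) ω) P := by
  classical
  have hd : Disjoint (Finset.univ.image g) (Finset.univ.image g') := by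
    rw [Finset.disjoint_left]
    intro a ha ha'
    obtain ⟨w, -, rfl⟩ := Finset.mem_image.1 ha
    obtain ⟨w', -, h⟩ := Finset.mem_image.1 ha'
    exact hgg w w' h.symm
  have h1 := hX.indepFun_finset _ _ hd hXm
  have h2 : ∀ g : κ → ℕ, Measurable fun a : ↥(Finset.univ.image g) → 𝓧 =>
      ψ fun w => a ⟨g w, Finset.mem_image_of_mem g (Finset.mem_univ w)⟩ := fun g =>
    hψ.comp (measurable_pi_lambda _ fun w => measurable_pi_apply _)
  exact h1.comp (h2 g) (h2 g')

/-- A law of large numbers for a local function evaluated at translates of a pattern, under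
independent identically distributed inputs. -/
theorem ae_tendsto_average_pattern (hX : iIndepFun X P) (hXm : ∀ i, Measurable (X i))
    (hXL : ∀ i, P.map (X i) = L) {ψ : (κ → 𝓧) → ℝ} (hψ : Measurable ψ) (g : ℕ → κ → ℕ)
    (good : Set ℕ) (hg : ∀ i ∈ good, (g i).Injective) {C : ℝ}
    (hC : ∀ i ∈ good, ∀ ω, |ψ fun w => X (g i w) ω| ≤ C) (N : ℕ → Finset ℕ) {D : ℕ}
    (hN : ∀ i, (N i).card ≤ D)
    (hgg : ∀ i ∈ good, ∀ j ∈ good, j ∉ N i → ∀ w w', g i w ≠ g j w') :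
    ∀ᵐ ω ∂P, Tendsto (fun n : ℕ => (∑ i ∈ Finset.range n, good.indicator
      (fun i => (ψ fun w => X (g i w) ω) - ∫ a, ψ a ∂(Measure.pi fun _ => L)) i) / n)
      atTop (nhds 0) := by
  classical
  set μ := ∫ a, ψ a ∂(Measure.pi fun _ : κ => L)
  have hpm : ∀ i, Measurable fun ω w => X (g i w) ω :=
    fun i => measurable_pi_lambda _ fun w => hXm _
  have hYm : ∀ i, Measurable fun ω => ψ fun w => X (g i w) ω := fun i => hψ.comp (hpm i)
  have hμ : ∀ i ∈ good, ∫ ω, (ψ fun w => X (g i w) ω) ∂P = μ := by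
    intro i hi
    rw [← integral_map (hpm i).aemeasurable hψ.aestronglyMeasurable,
      map_pattern_eq_pi hX hXm hXL (hg i hi)]
  have hYi : ∀ i ∈ good, Integrable (fun ω => ψ fun w => X (g i w) ω) P := fun i hi =>
    Integrable.of_bound (hYm i).aestronglyMeasurable C (ae_of_all _ (hC i hi))
  let U : ℕ → Ω → ℝ := fun i ω => good.indicator (fun i => (ψ fun w => X (g i w) ω) - μ) i
  have hUg : ∀ i ∈ good, U i = fun ω => (ψ fun w => X (g i w) ω) - μ := fun i hi => by
    funext ω; exact Set.indicator_of_mem hi _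
  have hUb : ∀ i, i ∉ good → U i = 0 := fun i hi => by
    funext ω; exact Set.indicator_of_notMem hi _
  have hUm : ∀ i, Measurable (U i) := fun i => by
    by_cases hi : i ∈ good
    · rw [hUg i hi]; exact (hYm i).sub_const _
    · rw [hUb i hi]; exact measurable_zero
  have hUC : ∀ i ω, |U i ω| ≤ 2 * |C| := fun i ω => by
    by_cases hi : i ∈ good
    · have h1 : |μ| ≤ C := by
        rw [← hμ i hi]
        have := norm_integral_le_of_norm_le_const (μ := P)
          (f := fun ω => ψ fun w => X (g i w) ω) (ae_of_all _ (hC i hi))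
        simpa using this
      rw [hUg i hi]
      have h2 := abs_sub (ψ fun w => X (g i w) ω) μ
      linarith [hC i hi ω, le_abs_self C]
    · rw [hUb i hi]; simp
  have hU0 : ∀ i ∈ good, ∫ ω, U i ω ∂P = 0 := fun i hi => by
    rw [hUg i hi, integral_sub (hYi i hi) (integrable_const _), hμ i hi]; simp
  refine ae_tendsto_average_zero (U := U) hUm hUC
    (integral_sq_sum_le hUm hUC N hN fun i j hij => ?_)
  by_cases hi : i ∈ good
  swap
  · simp [hUb i hi]
  by_cases hj : j ∈ good
  swap
  · simp [hUb j hj]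
  have hind : IndepFun (U i) (U j) P := by
    rw [hUg i hi, hUg j hj]
    exact (indepFun_pattern hX hXm hψ (hgg i hi j hj hij)).comp
      (measurable_id.sub_const μ) (measurable_id.sub_const μ)
  rw [hind.integral_fun_mul_eq_mul_integral (hUm i).aestronglyMeasurable
    (hUm j).aestronglyMeasurable, hU0 i hi, zero_mul]

end LLN

end PerturbedGrid

/-! ### Lattice kernels and regularity of the covariance model. -/

namespace PerturbedGrid

open MeasureTheory Filter

section Kernels

variable {d : ℕ}

/-- A summable majorant, on the lattice, of kernels with polynomial decay of order `d + 1`. -/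
noncomputable def latticeMajorant (d : ℕ) (ε C : ℝ) (w : Fin d → ℤ) : ℝ :=
  C / (1 + ((1 - 2 * ε) * ‖w‖) ^ (d + 1))

lemma latticeMajorant_nonneg {ε C : ℝ} (hε : ε < 1 / 2) (hC : 0 ≤ C) (w : Fin d → ℤ) :
    0 ≤ latticeMajorant d ε C w := by
  have : 0 ≤ 1 - 2 * ε := by linarith
  unfold latticeMajorant; positivity

lemma summable_latticeMajorant {ε C : ℝ} (hε : ε < 1 / 2) (hC : 0 ≤ C) :
    Summable (latticeMajorant d ε C) := by
  have hδ : 0 < 1 - 2 * ε := by linarith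
  refine Summable.of_norm_bounded_eventually
    ((summable_norm_pow_inv d).mul_left (C * ((1 - 2 * ε) ^ (d + 1))⁻¹)) ?_
  -- The comparison is needed only off the origin, where the inverse power takes the junk value
  -- zero.
  refine (Set.finite_singleton (0 : Fin d → ℤ)).subset fun w hw => ?_
  by_contra h0
  refine hw ?_
  have hn : 0 < ‖w‖ := norm_pos_iff.2 h0
  rw [Set.mem_ofPred_eq, Real.norm_eq_abs, abs_of_nonneg (latticeMajorant_nonneg hε hC w),
    latticeMajorant, mul_assoc, ← mul_inv, ← mul_pow, ← div_eq_mul_inv]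
  exact div_le_div_of_nonneg_left hC (by positivity) (by linarith)

lemma abs_gridMatrix_le {ε C : ℝ} (hε₀ : 0 ≤ ε) (hε : ε < 1 / 2)
    {k : EuclideanSpace ℝ (Fin d) → ℝ} (hk : ∀ t, |k t| ≤ C / (1 + ‖t‖ ^ (d + 1))) {ι : Type*}
    (u : ι → Fin d → ℤ) {z : ι → EuclideanSpace ℝ (Fin d)} (hz : z ∈ cubeConfig d) (i j : ι) :
    |gridMatrix k ε z u i j| ≤ latticeMajorant d ε C (u i - u j) := by
  have hδ : 0 < 1 - 2 * ε := by linarith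
  have hC : 0 ≤ C := by
    have := (abs_nonneg _).trans (hk 0)
    simpa using this
  refine (hk _).trans (div_le_div_of_nonneg_left hC (by positivity) ?_)
  have := pow_le_pow_left₀ (by positivity) (norm_sub_le_norm_gridPoint_sub hε₀ hz u i j) (d + 1)
  linarith

lemma continuous_cosTransform {g : EuclideanSpace ℝ (Fin d) → ℝ} (hg : Integrable g) :
    Continuous (cosTransform g) := by
  refine continuous_of_dominated (bound := fun f => ‖g f‖)
    (fun t => (integrable_mul_cos hg t).aestronglyMeasurable) (fun t => ae_of_all _ fun f => ?_)
    hg.norm (ae_of_all _ fun f => by fun_prop)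
  rw [norm_mul]
  exact mul_le_of_le_one_right (norm_nonneg _) (by
    rw [Real.norm_eq_abs]; exact Real.abs_cos_le_one _)

lemma gridMatrix_submatrix {ι κ : Type*} (k : EuclideanSpace ℝ (Fin d) → ℝ) (ε : ℝ)
    (z : ι → EuclideanSpace ℝ (Fin d)) (u : ι → Fin d → ℤ) (e : κ → ι) :
    (gridMatrix k ε z u).submatrix e e = gridMatrix k ε (z ∘ e) (u ∘ e) := rfl

/-- Only differences enter. This makes the block about any site the same function of the
perturbations there. -/
lemma gridMatrix_translate {ι : Type*} (k : EuclideanSpace ℝ (Fin d) → ℝ) (ε : ℝ)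
    (z : ι → EuclideanSpace ℝ (Fin d)) (u : ι → Fin d → ℤ) (a : Fin d → ℤ) :
    gridMatrix k ε z (fun i => a + u i) = gridMatrix k ε z u := by
  ext i j
  simp only [gridMatrix, Matrix.of_apply, latticePoint_sub, add_sub_add_left_eq_sub]

lemma continuous_gridMatrix_apply {ι : Type*} {k : EuclideanSpace ℝ (Fin d) → ℝ}
    (hk : Continuous k) (ε : ℝ) (u : ι → Fin d → ℤ) (i j : ι) :
    Continuous fun z : ι → EuclideanSpace ℝ (Fin d) => gridMatrix k ε z u i j := by
  simp only [gridMatrix, Matrix.of_apply]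
  fun_prop

end Kernels

section Model

variable {d p : ℕ} {a b : ℝ} {K : (Fin p → ℝ) → EuclideanSpace ℝ (Fin d) → ℝ} {θ₀ : Fin p → ℝ}

lemma hasDerivAt_partialWithin {Θ : Set (Fin p → ℝ)} {F : (Fin p → ℝ) → ℝ}
    (hF : DifferentiableOn ℝ F Θ) (i : Fin p) {x : Fin p → ℝ} {s : ℝ}
    (hs : Θ ∈ nhds (x + s • Pi.single i (1 : ℝ))) :
    HasDerivAt (fun r : ℝ => F (x + r • Pi.single i (1 : ℝ)))
      (partialWithin Θ i F (x + s • Pi.single i (1 : ℝ))) s := by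
  have hd : DifferentiableAt ℝ F (x + s • Pi.single i (1 : ℝ)) :=
    (hF _ (mem_of_mem_nhds hs)).differentiableAt hs
  have h1 : partialWithin Θ i F (x + s • Pi.single i (1 : ℝ)) =
      fderiv ℝ F (x + s • Pi.single i (1 : ℝ)) (Pi.single i 1) := by
    rw [partialWithin, lineDerivWithin_of_mem_nhds hs, hd.lineDeriv_eq_fderiv]
  rw [h1]
  have h2 : HasDerivAt (fun r : ℝ => x + r • (Pi.single i (1 : ℝ) : Fin p → ℝ))
      (Pi.single i (1 : ℝ)) s := by
    simpa using ((hasDerivAt_id s).smul_const (Pi.single i (1 : ℝ) : Fin p → ℝ)).const_add x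
  exact hd.hasFDerivAt.comp_hasDerivAt s h2

lemma paramBox_mem_nhds (hθ₀ : ∀ i, a < θ₀ i ∧ θ₀ i < b) : paramBox p a b ∈ nhds θ₀ :=
  pi_Icc_mem_nhds' (fun i => (hθ₀ i).1) fun i => (hθ₀ i).2

/-- The spectral representation, in real form. -/
lemma IsRegularModel.eq_cosTransform {Θ : Set (Fin p → ℝ)} (hK : IsRegularModel Θ K)
    {θ : Fin p → ℝ} (hθ : θ ∈ Θ) (t : EuclideanSpace ℝ (Fin d)) :
    K θ t = cosTransform (fun f => (fourierHat (K θ) f).re) t := by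
  have hI : Integrable fun f : EuclideanSpace ℝ (Fin d) =>
      fourierHat (K θ) f * Complex.exp (Complex.I * (inner ℝ f t : ℝ)) := by
    refine (hK.integrable_hat θ hθ).mul_bdd (c := 1)
      (Continuous.aestronglyMeasurable (by fun_prop)) (ae_of_all _ fun f => ?_)
    rw [mul_comm, Complex.norm_exp_ofReal_mul_I]
  have h1 := congrArg Complex.re (hK.inversion θ hθ t)
  rw [Complex.ofReal_re] at h1
  have h2 := integral_re hI
  simp only [RCLike.re_to_complex] at h2
  rw [h1, ← h2, cosTransform]
  refine integral_congr_ae (ae_of_all _ fun f => ?_)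
  simp only
  rw [Complex.mul_re, hK.hat_real θ hθ f, zero_mul, sub_zero, mul_comm Complex.I,
    Complex.exp_ofReal_mul_I_re]

lemma IsRegularModel.integrable_hat_re {Θ : Set (Fin p → ℝ)} (hK : IsRegularModel Θ K)
    {θ : Fin p → ℝ} (hθ : θ ∈ Θ) : Integrable fun f => (fourierHat (K θ) f).re :=
  (hK.integrable_hat θ hθ).re

lemma IsRegularModel.continuous {Θ : Set (Fin p → ℝ)} (hK : IsRegularModel Θ K)
    {θ : Fin p → ℝ} (hθ : θ ∈ Θ) : Continuous (K θ) := by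
  rw [funext (hK.eq_cosTransform hθ)]
  exact continuous_cosTransform (hK.integrable_hat_re hθ)

lemma IsRegularModel.exists_isCoercive {Θ : Set (Fin p → ℝ)} (hK : IsRegularModel Θ K)
    {θ : Fin p → ℝ} (hθ : θ ∈ Θ) {ε : ℝ} (hε₀ : 0 ≤ ε) (hε : ε < 1 / 2) :
    ∃ c, 0 < c ∧ ∀ {ι : Type} [Fintype ι] (u : ι → Fin d → ℤ), u.Injective →
      ∀ z ∈ cubeConfig (α := ι) d, IsCoercive c (gridMatrix (K θ) ε z u) := by
  refine exists_isCoercive_gridMatrix hε₀ hε (hK.integrable_hat_re hθ) ?_ (hK.hat_pos θ hθ)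
    (hK.eq_cosTransform hθ)
  refine Complex.continuous_re.comp (continuousOn_univ.1 ?_)
  exact hK.continuous_hat.comp (f := fun f => (f, θ)) (by fun_prop) fun f _ => ⟨trivial, hθ⟩

/-- The partial derivatives of the covariance function are continuous in the lag. -/
lemma IsRegularModel.continuous_partialWithin (hK : IsRegularModel (paramBox p a b) K)
    (hθ₀ : ∀ i, a < θ₀ i ∧ θ₀ i < b) (i : Fin p) :
    Continuous fun t => partialWithin (paramBox p a b) i (fun θ => K θ t) θ₀ := by
  set Θ := paramBox p a b
  set e : Fin p → ℝ := Pi.single i 1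
  -- The second derivative is bounded uniformly in the lag, so difference quotients in `θ` converge
  -- uniformly in `t`; their limit inherits continuity.
  obtain ⟨C, hC⟩ := hK.decay [i, i] (by simp)
  have hC0 : 0 ≤ C := by
    have := (abs_nonneg _).trans (hC θ₀ (mem_of_mem_nhds (paramBox_mem_nhds hθ₀)) 0)
    simpa using this
  have hC' : ∀ θ ∈ Θ, ∀ t, |partialWithin Θ i (partialWithin Θ i fun θ => K θ t) θ| ≤ C :=
    fun θ hθ t => (hC θ hθ t).trans
      (div_le_self hC0 (by linarith [pow_nonneg (norm_nonneg t) (d + 1)]))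
  have hpath : Tendsto (fun s : ℝ => θ₀ + s • e) (nhds 0) (nhds θ₀) := by
    have : Continuous fun s : ℝ => θ₀ + s • e := by fun_prop
    simpa using this.tendsto 0
  obtain ⟨r, hr, hball⟩ := Metric.mem_nhds_iff.1
    (hpath.eventually (eventually_mem_nhds_iff.2 (paramBox_mem_nhds hθ₀)))
  have hmem : ∀ s : ℝ, |s| < r → Θ ∈ nhds (θ₀ + s • e) := fun s hs =>
    hball (by simpa [Real.dist_eq] using hs)
  have hd1 : ∀ t, DifferentiableOn ℝ (fun θ => K θ t) Θ := hK.differentiable [] (by simp)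
  have hd2 : ∀ t, DifferentiableOn ℝ (partialWithin Θ i fun θ => K θ t) Θ :=
    hK.differentiable [i] (by simp)
  have hlip : ∀ t (s : ℝ), |s| < r → |partialWithin Θ i (fun θ => K θ t) (θ₀ + s • e) -
      partialWithin Θ i (fun θ => K θ t) θ₀| ≤ C * |s| := by
    intro t s hs
    have h := (convex_ball (0 : ℝ) r).norm_image_sub_le_of_norm_hasDerivWithin_le
      (f := fun s : ℝ => partialWithin Θ i (fun θ => K θ t) (θ₀ + s • e)) (C := C)
      (f' := fun s => partialWithin Θ i (partialWithin Θ i fun θ => K θ t) (θ₀ + s • e))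
      (fun x hx => (hasDerivAt_partialWithin (hd2 t) i
        (hmem x (by simpa using hx))).hasDerivWithinAt)
      (fun x hx => hC' _ (mem_of_mem_nhds (hmem x (by simpa using hx))) t)
      (Metric.mem_ball_self hr) (y := s) (by simpa using hs)
    simpa using h
  have hquot : ∀ t (s : ℝ), |s| < r → s ≠ 0 →
      |s⁻¹ * (K (θ₀ + s • e) t - K θ₀ t) - partialWithin Θ i (fun θ => K θ t) θ₀| ≤ C * |s| := by
    intro t s hs hs0
    set D := partialWithin Θ i (fun θ => K θ t) θ₀
    have hsub : ∀ x ∈ Metric.closedBall (0 : ℝ) |s|, |x| < r := fun x hx =>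
      lt_of_le_of_lt (by simpa using hx) hs
    -- Mean value inequality for `K` minus its linear part, whose derivative is at most `C * |s|` on
    -- this ball by `hlip`.
    have h := (convex_closedBall (0 : ℝ) |s|).norm_image_sub_le_of_norm_hasDerivWithin_le
      (f := fun x : ℝ => K (θ₀ + x • e) t - x * D) (C := C * |s|)
      (f' := fun x => partialWithin Θ i (fun θ => K θ t) (θ₀ + x • e) - D)
      (fun x hx => ((hasDerivAt_partialWithin (hd1 t) i (hmem x (hsub x hx))).sub
        (by simpa using (hasDerivAt_id x).mul_const D)).hasDerivWithinAt)
      (fun x hx => (hlip t x (hsub x hx)).trans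
        (mul_le_mul_of_nonneg_left (by simpa using hx) hC0))
      (Metric.mem_closedBall_self (abs_nonneg s)) (y := s) (by simp)
    simp only [zero_smul, add_zero, zero_mul, sub_zero, Real.norm_eq_abs] at h
    have h2 : s⁻¹ * (K (θ₀ + s • e) t - K θ₀ t) - D =
        s⁻¹ * (K (θ₀ + s • e) t - s * D - K θ₀ t) := by field_simp; ring
    rw [h2, abs_mul, abs_inv, inv_mul_le_iff₀ (abs_pos.2 hs0), mul_comm |s|]
    exact h
  refine continuous_of_uniform_approx_of_continuous fun u hu => ?_
  obtain ⟨δ, hδ, hδu⟩ := Metric.mem_uniformity_dist.1 hu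
  obtain ⟨s, hs0, hs⟩ : ∃ s : ℝ, 0 < s ∧ s < min r (δ / (C + 1)) := exists_between (by positivity)
  have hsr : |s| < r := by rw [abs_of_pos hs0]; exact hs.trans_le (min_le_left _ _)
  refine ⟨fun t => s⁻¹ * (K (θ₀ + s • e) t - K θ₀ t), ?_, fun t => hδu ?_⟩
  · exact continuous_const.mul ((hK.continuous (mem_of_mem_nhds (hmem s hsr))).sub
      (hK.continuous (mem_of_mem_nhds (paramBox_mem_nhds hθ₀))))
  · rw [dist_comm, Real.dist_eq]
    refine (hquot t s hsr hs0.ne').trans_lt ?_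
    have h1 := hs.trans_le (min_le_right _ _)
    rw [lt_div_iff₀ (by positivity)] at h1
    rw [abs_of_pos hs0]
    nlinarith

/-- Evenness of the covariance holds throughout `Θ` and so passes to derivatives within `Θ`; it
makes the derivative matrices symmetric. -/
lemma IsRegularModel.partialWithin_neg {Θ : Set (Fin p → ℝ)} (hK : IsRegularModel Θ K)
    {θ : Fin p → ℝ} (hθ : θ ∈ Θ) (i : Fin p) (t : EuclideanSpace ℝ (Fin d)) :
    partialWithin Θ i (fun θ => K θ (-t)) θ = partialWithin Θ i (fun θ => K θ t) θ :=
  lineDerivWithin_congr (fun θ' hθ' => (hK.covariance θ' hθ').symm t)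
    ((hK.covariance θ hθ).symm t)

lemma IsRegularModel.continuous_dirDeriv (hK : IsRegularModel (paramBox p a b) K)
    (hθ₀ : ∀ i, a < θ₀ i ∧ θ₀ i < b) (lam : Fin p → ℝ) :
    Continuous (dirDeriv (paramBox p a b) K θ₀ lam) :=
  continuous_finsetSum _ fun i _ => continuous_const.mul (hK.continuous_partialWithin hθ₀ i)

/-- One constant bounds the covariance function and its first partial derivatives. -/
lemma IsRegularModel.exists_decay {Θ : Set (Fin p → ℝ)} (hK : IsRegularModel Θ K)
    {θ : Fin p → ℝ} (hθ : θ ∈ Θ) : ∃ C, 0 ≤ C ∧ (∀ t, |K θ t| ≤ C / (1 + ‖t‖ ^ (d + 1))) ∧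
      ∀ i t, |partialWithin Θ i (fun θ => K θ t) θ| ≤ C / (1 + ‖t‖ ^ (d + 1)) := by
  obtain ⟨C₀, h₀⟩ := hK.decay [] (by simp)
  choose C₁ h₁ using fun i : Fin p => hK.decay [i] (by simp)
  have hs : 0 ≤ ∑ i, |C₁ i| := Finset.sum_nonneg fun i _ => abs_nonneg _
  refine ⟨|C₀| + ∑ i, |C₁ i|, by positivity, fun t => (h₀ θ hθ t).trans ?_,
    fun i t => (h₁ i θ hθ t).trans ?_⟩
  · gcongr
    linarith [le_abs_self C₀]
  · gcongr
    have := Finset.single_le_sum (f := fun i => |C₁ i|) (fun i _ => abs_nonneg _)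
      (Finset.mem_univ i)
    linarith [le_abs_self (C₁ i), abs_nonneg C₀]

end Model

end PerturbedGrid

/-! ### The enumeration of the grid, its boundary and its cubes. -/

namespace PerturbedGrid

open MeasureTheory Filter

section Enumeration

variable {d : ℕ} {v : ℕ → Fin d → ℤ}

lemma IsGridEnumeration.image_range (hv : IsGridEnumeration v) {N : ℕ} (hN : 1 ≤ N) :
    (Finset.range (N ^ d)).image v = Finset.Icc (fun _ => (1 : ℤ)) (fun _ => (N : ℤ)) := by
  classical
  apply Finset.coe_injective
  rw [Finset.coe_image, Finset.coe_Icc]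
  have h := hv N hN
  have h1 : ((Finset.range (N ^ d) : Finset ℕ) : Set ℕ) = {i | i < N ^ d} := by ext; simp
  rw [h1, h]
  ext w
  simp only [Set.mem_ofPred_eq, Set.mem_Icc, Pi.le_def]
  exact forall_and

/-- The first `N ^ d` indices cover `N ^ d` points, which forces injectivity there; `d > 0` makes
these initial segments exhaust `ℕ`. -/
lemma IsGridEnumeration.injective (hd : 0 < d) (hv : IsGridEnumeration v) : v.Injective := by
  intro i j hij
  have hle : ∀ N : ℕ, N ≤ N ^ d := fun N => Nat.le_self_pow hd.ne' N
  have hN : 1 ≤ max i j + 1 := by omega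
  have h1 := hv.image_range hN
  have h2 : ((Finset.range ((max i j + 1) ^ d)).image v).card =
      (Finset.range ((max i j + 1) ^ d)).card := by
    rw [h1, Pi.card_Icc]
    simp only [Int.card_Icc, Finset.prod_const, Finset.card_univ, Fintype.card_fin,
      Finset.card_range]
    congr 1
    omega
  have h3 := Finset.card_image_iff.1 h2
  have h4 := hle (max i j + 1)
  exact h3 (by simp; omega) (by simp; omega) hij

/-- The cube of radius `ρ` in the lattice, centred at the origin. -/
noncomputable abbrev latticeBox (d ρ : ℕ) : Finset (Fin d → ℤ) :=
  Finset.Icc (fun _ => -(ρ : ℤ)) (fun _ => (ρ : ℤ))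

/-- The indices below `n` whose cube of radius `ρ` is not contained in the first `n` sites. -/
noncomputable def boundaryIndices (v : ℕ → Fin d → ℤ) (ρ n : ℕ) : Finset ℕ :=
  open Classical in
  (Finset.range n).filter fun i => ∃ w ∈ latticeBox d ρ, ∀ j < n, v j ≠ v i + w

/-- The first `n` sites lie between the cubes of sides `N` and `N + 1`. Boundary sites are in the
larger cube but not in the smaller one shrunk by `ρ` on each side. Truncated subtraction matches an
empty shrunk cube. -/
lemma IsGridEnumeration.card_boundaryIndices_le (hd : 0 < d) (hv : IsGridEnumeration v) (ρ : ℕ)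
    {N n : ℕ} (hN : 1 ≤ N) (hNn : N ^ d ≤ n) (hnN : n ≤ (N + 1) ^ d) :
    (boundaryIndices v ρ n).card ≤ (N + 1) ^ d - (N - 2 * ρ) ^ d := by
  classical
  have hinj := hv.injective hd
  set Q : Finset (Fin d → ℤ) := Finset.Icc (fun _ => (1 : ℤ)) (fun _ => ((N + 1 : ℕ) : ℤ))
  set q : Finset (Fin d → ℤ) := Finset.Icc (fun _ => (ρ + 1 : ℤ)) (fun _ => (N - ρ : ℤ))
  have hqQ : q ⊆ Q := Finset.Icc_subset_Icc (fun _ => by simp) (fun _ => by push_cast; linarith)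
  have hcard : (Q \ q).card = (N + 1) ^ d - (N - 2 * ρ) ^ d := by
    rw [Finset.card_sdiff_of_subset hqQ, Pi.card_Icc, Pi.card_Icc]
    simp only [Int.card_Icc, Finset.prod_const, Finset.card_univ, Fintype.card_fin]
    congr 2 <;> omega
  rw [← hcard, ← Finset.card_image_of_injective _ hinj]
  refine Finset.card_le_card fun x hx => ?_
  obtain ⟨i, hi, rfl⟩ := Finset.mem_image.1 hx
  obtain ⟨hin, w, hw, hwn⟩ := Finset.mem_filter.1 hi
  rw [Finset.mem_sdiff]
  refine ⟨?_, fun hq => ?_⟩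
  · rw [show Q = _ from (hv.image_range (N := N + 1) (by omega)).symm]
    exact Finset.mem_image_of_mem v (Finset.mem_range.2 ((Finset.mem_range.1 hin).trans_le hnN))
  · have h1 : v i + w ∈ (Finset.range (N ^ d)).image v := by
      rw [hv.image_range hN]
      simp only [q, Finset.mem_Icc, Pi.le_def] at hq hw ⊢
      exact ⟨fun k => by have := hq.1 k; have := hw.1 k; simp only [Pi.add_apply]; linarith,
        fun k => by have := hq.2 k; have := hw.2 k; simp only [Pi.add_apply]; linarith⟩
    obtain ⟨j, hj, hjw⟩ := Finset.mem_image.1 h1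
    exact hwn j ((Finset.mem_range.1 hj).trans_le hNn) hjw

lemma exists_pow_le_lt_succ_pow (hd : 0 < d) {n : ℕ} (hn : 1 ≤ n) :
    ∃ N, 1 ≤ N ∧ N ^ d ≤ n ∧ n < (N + 1) ^ d := by
  have hex : ∃ N, n < (N + 1) ^ d :=
    ⟨n, lt_of_lt_of_le (Nat.lt_succ_self n) (Nat.le_self_pow hd.ne' _)⟩
  classical
  have h1 := Nat.find_spec hex
  have h0 : 1 ≤ Nat.find hex := by
    by_contra h
    have h2 : Nat.find hex = 0 := by omega
    rw [h2] at h1; simp at h1; omega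
  refine ⟨Nat.find hex, h0, ?_, h1⟩
  have := Nat.find_min hex (m := Nat.find hex - 1) (by omega)
  rw [Nat.sub_add_cancel h0] at this
  omega

lemma IsGridEnumeration.tendsto_card_boundaryIndices (hd : 0 < d) (hv : IsGridEnumeration v)
    (ρ : ℕ) : Tendsto (fun n : ℕ => ((boundaryIndices v ρ n).card : ℝ) / n) atTop (nhds 0) := by
  have hN : ∀ n : ℕ, ∃ N, 1 ≤ n → 1 ≤ N ∧ N ^ d ≤ n ∧ n < (N + 1) ^ d := fun n => by
    by_cases hn : 1 ≤ n
    · obtain ⟨N, h⟩ := exists_pow_le_lt_succ_pow hd hn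
      exact ⟨N, fun _ => h⟩
    · exact ⟨0, fun h => absurd h hn⟩
  choose N hN using hN
  have hNt : Tendsto N atTop atTop := by
    refine tendsto_atTop_atTop.2 fun b => ⟨(b + 1) ^ d, fun n hn => ?_⟩
    have h1 := hN n (by
      have := Nat.one_le_pow d (b + 1) (by omega); omega)
    have h2 := hn.trans_lt h1.2.2
    have := lt_of_pow_lt_pow_left₀ d (by omega) h2
    omega
  have hlim : Tendsto (fun N : ℕ => (1 + 1 / (N : ℝ)) ^ d - (1 - 2 * ρ / (N : ℝ)) ^ d) atTop
      (nhds 0) := by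
    have h1 := (tendsto_const_div_atTop_nhds_zero_nat (1 : ℝ)).const_add 1
    have h2 := (tendsto_const_div_atTop_nhds_zero_nat (2 * ρ : ℝ)).const_sub 1
    simpa using (h1.pow d).sub (h2.pow d)
  refine squeeze_zero' (Eventually.of_forall fun n => by positivity) ?_ (hlim.comp hNt)
  filter_upwards [eventually_ge_atTop 1, hNt.eventually_ge_atTop (2 * ρ)] with n hn hρ
  obtain ⟨h1, h2, h3⟩ := hN n hn
  have h4 := hv.card_boundaryIndices_le hd ρ h1 h2 h3.le
  have hle : (N n - 2 * ρ) ^ d ≤ (N n + 1) ^ d := Nat.pow_le_pow_left (by omega) d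
  have h5 : ((boundaryIndices v ρ n).card : ℝ) ≤ (N n + 1) ^ d - (N n - 2 * ρ : ℝ) ^ d := by
    have : ((boundaryIndices v ρ n).card : ℝ) ≤ (((N n + 1) ^ d - (N n - 2 * ρ) ^ d : ℕ) : ℝ) := by
      exact_mod_cast h4
    rw [Nat.cast_sub hle] at this
    push_cast [Nat.cast_sub hρ] at this
    exact this
  have hNp : (0 : ℝ) < N n := by exact_mod_cast h1
  have h6 : ((N n : ℝ)) ^ d ≤ n := by exact_mod_cast h2
  simp only [Function.comp]
  rw [show (1 + 1 / (N n : ℝ)) = (N n + 1) / N n by field_simp,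
    show (1 - 2 * ρ / (N n : ℝ)) = (N n - 2 * ρ) / N n by field_simp, div_pow, div_pow, ← sub_div]
  exact (div_le_div_of_nonneg_left (by positivity) (by positivity) h6).trans
    (div_le_div_of_nonneg_right h5 (by positivity))

/-- The index of the site `v i + w`. -/
noncomputable def neighbourIndex (v : ℕ → Fin d → ℤ) (ρ i : ℕ) (w : latticeBox d ρ) : ℕ :=
  Function.invFun v (v i + w)

/-- The indices of the sites whose cube of radius `ρ` is contained in the positive orthant. -/
def interiorIndices (v : ℕ → Fin d → ℤ) (ρ : ℕ) : Set ℕ :=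
  {i | ∀ w : latticeBox d ρ, v (neighbourIndex v ρ i w) = v i + w}

lemma neighbourIndex_injective {ρ i : ℕ} (hi : i ∈ interiorIndices v ρ) :
    (neighbourIndex v ρ i).Injective := fun w w' h => by
  have h1 := hi w
  rw [h, hi w'] at h1
  exact Subtype.ext (add_left_cancel h1).symm

lemma neighbourIndex_zero (hinj : v.Injective) {ρ i : ℕ} (hi : i ∈ interiorIndices v ρ)
    (w : latticeBox d ρ) (hw : (w : Fin d → ℤ) = 0) : neighbourIndex v ρ i w = i :=
  hinj (by rw [hi w, hw, add_zero])

lemma mem_interiorIndices_of_notMem {ρ n i : ℕ} (hi : i < n)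
    (hb : i ∉ boundaryIndices v ρ n) : i ∈ interiorIndices v ρ := by
  intro w
  by_contra h
  refine hb (Finset.mem_filter.2 ⟨Finset.mem_range.2 hi, w, w.2, fun j _ hj => h ?_⟩)
  exact Function.invFun_eq ⟨j, hj⟩

lemma neighbourIndex_lt (hinj : v.Injective) {ρ n i : ℕ} (hi : i < n)
    (hb : i ∉ boundaryIndices v ρ n) (w : latticeBox d ρ) : neighbourIndex v ρ i w < n := by
  by_contra h
  refine hb (Finset.mem_filter.2 ⟨Finset.mem_range.2 hi, w, w.2, fun j hj hjw => h ?_⟩)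
  rwa [hinj (hjw.trans (mem_interiorIndices_of_notMem hi hb w).symm)] at hj

open Classical in
/-- The indices of the sites whose cube of radius `ρ` may meet that of `v i`. -/
noncomputable def overlapIndices (v : ℕ → Fin d → ℤ) (ρ i : ℕ) : Finset ℕ :=
  Finset.univ.image fun w : latticeBox d ρ × latticeBox d ρ =>
    Function.invFun v (v i + w.1 - w.2)

lemma card_overlapIndices_le (v : ℕ → Fin d → ℤ) (ρ i : ℕ) :
    (overlapIndices v ρ i).card ≤ Fintype.card (latticeBox d ρ × latticeBox d ρ) :=
  Finset.card_image_le

/-- A common site would give `v j = v i + w - w'`, which puts `j` in the overlap set. -/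
lemma neighbourIndex_ne (hinj : v.Injective) {ρ i j : ℕ} (hi : i ∈ interiorIndices v ρ)
    (hj : j ∈ interiorIndices v ρ) (hij : j ∉ overlapIndices v ρ i) (w w' : latticeBox d ρ) :
    neighbourIndex v ρ i w ≠ neighbourIndex v ρ j w' := by
  intro h
  refine hij (Finset.mem_image.2 ⟨(w, w'), Finset.mem_univ _, ?_⟩)
  have h1 := hi w
  rw [h, hj w'] at h1
  simp only [← h1, add_sub_cancel_right]
  exact Function.leftInverse_invFun hinj j

end Enumeration

/-! ### Averages up to sparse exceptions and small errors. -/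

section Averages

/-- Averages that agree off a sparse set with a quantity whose average vanishes. -/
lemma eventually_abs_average_sub_le {t : ℕ → ℕ → ℝ} {Y : ℕ → ℝ} {bad : ℕ → Finset ℕ} {m η B : ℝ}
    (hbad : Tendsto (fun n : ℕ => ((bad n).card : ℝ) / n) atTop (nhds 0)) (hη : 0 ≤ η)
    (hY : Tendsto (fun n : ℕ => (∑ i ∈ Finset.range n, Y i) / n) atTop (nhds 0))
    (hgood : ∀ n, ∀ i < n, i ∉ bad n → |t n i - m - Y i| ≤ η)
    (hB : ∀ n, ∀ i < n, |t n i - m - Y i| ≤ B) {δ : ℝ} (hδ : 0 < δ) :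
    ∀ᶠ n : ℕ in atTop, |(∑ i ∈ Finset.range n, t n i) / n - m| ≤ η + δ := by
  classical
  have hlim : Tendsto (fun n : ℕ => |(∑ i ∈ Finset.range n, Y i) / n| +
      |B| * (((bad n).card : ℝ) / n)) atTop (nhds 0) := by
    simpa using hY.abs.add (hbad.const_mul |B|)
  filter_upwards [eventually_ge_atTop 1, hlim.eventually_lt_const hδ] with n hn hlt
  have hn0 : (0 : ℝ) < n := by exact_mod_cast hn
  have h1 : |∑ i ∈ Finset.range n, (t n i - m - Y i)| ≤ n * η + (bad n).card * |B| := by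
    have h2 : ∀ i ∈ Finset.range n, |t n i - m - Y i| ≤ η + if i ∈ bad n then |B| else 0 := by
      intro i hi
      have hi' := Finset.mem_range.1 hi
      split_ifs with hb
      · linarith [hB n i hi', le_abs_self B]
      · linarith [hgood n i hi' hb]
    refine (Finset.abs_sum_le_sum_abs _ _).trans ((Finset.sum_le_sum h2).trans ?_)
    rw [Finset.sum_add_distrib, ← Finset.sum_filter, Finset.sum_const, Finset.sum_const,
      nsmul_eq_mul, nsmul_eq_mul, Finset.card_range]
    refine add_le_add le_rfl (mul_le_mul_of_nonneg_right ?_ (abs_nonneg B))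
    have : (Finset.range n).filter (· ∈ bad n) ⊆ bad n := fun j hj => (Finset.mem_filter.1 hj).2
    exact_mod_cast Finset.card_le_card this
  have h3 : (∑ i ∈ Finset.range n, t n i) / n - m =
      (∑ i ∈ Finset.range n, (t n i - m - Y i)) / n + (∑ i ∈ Finset.range n, Y i) / n := by
    rw [Finset.sum_sub_distrib, Finset.sum_sub_distrib]
    simp
    field_simp
    ring
  rw [h3]
  refine (abs_add_le _ _).trans ?_
  have h4 : |(∑ i ∈ Finset.range n, (t n i - m - Y i)) / n| ≤
      η + |B| * (((bad n).card : ℝ) / n) := by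
    rw [abs_div, Nat.abs_cast, div_le_iff₀ hn0]
    refine h1.trans (le_of_eq ?_)
    field_simp
  linarith

/-- The one-sided version of `eventually_abs_average_sub_le`. -/
lemma eventually_le_average {t : ℕ → ℕ → ℝ} {Y : ℕ → ℝ} {bad : ℕ → Finset ℕ} {m B : ℝ}
    (hbad : Tendsto (fun n : ℕ => ((bad n).card : ℝ) / n) atTop (nhds 0))
    (hY : Tendsto (fun n : ℕ => (∑ i ∈ Finset.range n, Y i) / n) atTop (nhds 0))
    (ht : ∀ n i, 0 ≤ t n i) (hgood : ∀ n, ∀ i < n, i ∉ bad n → m + Y i ≤ t n i)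
    (hB : ∀ i, |m + Y i| ≤ B) {δ : ℝ} (hδ : 0 < δ) :
    ∀ᶠ n : ℕ in atTop, m - δ ≤ (∑ i ∈ Finset.range n, t n i) / n := by
  classical
  -- Replacing the bad terms by zero gives a lower bound to which the two-sided version applies with
  -- no error.
  have h := eventually_abs_average_sub_le (t := fun n i => if i ∈ bad n then 0 else m + Y i)
    (m := m) (η := 0) (B := B) hbad le_rfl hY (fun n i _ hb => by simp [hb]) (fun n i _ => by
      split_ifs
      · have := hB i; rw [← abs_neg] at this; convert this using 2; ring
      · have := (abs_nonneg _).trans (hB i); simpa using this) hδ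
  filter_upwards [h] with n hn
  have h1 := neg_le_of_abs_le hn
  have h2 : (∑ i ∈ Finset.range n, if i ∈ bad n then 0 else m + Y i) / (n : ℝ) ≤
      (∑ i ∈ Finset.range n, t n i) / n := by
    refine div_le_div_of_nonneg_right (Finset.sum_le_sum fun i hi => ?_) (Nat.cast_nonneg n)
    split_ifs with hb
    · exact ht n i
    · exact hgood n i (Finset.mem_range.1 hi) hb
  linarith

/-- A single outcome already shows `|m ρ - m ρ'| ≤ η ρ + η ρ'`, so the deterministic sequence `m` is
Cauchy, and its limit serves for almost every outcome. -/
lemma exists_limit_of_approx {Ω : Type*} [MeasurableSpace Ω] {P : Measure Ω}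
    [IsProbabilityMeasure P] {A : ℕ → Ω → ℝ} {m η : ℕ → ℝ} (hη : Tendsto η atTop (nhds 0))
    (h : ∀ᵐ ω ∂P, ∀ ρ, ∀ δ > 0, ∀ᶠ n in atTop, |A n ω - m ρ| ≤ η ρ + δ) :
    ∃ s, ∀ᵐ ω ∂P, Tendsto (fun n => A n ω) atTop (nhds s) := by
  have hm : ∀ ρ ρ', |m ρ - m ρ'| ≤ η ρ + η ρ' := by
    obtain ⟨ω, hω⟩ := h.exists
    intro ρ ρ'
    refine le_of_forall_pos_le_add fun δ hδ => ?_
    obtain ⟨n, h1, h2⟩ :=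
      ((hω ρ (δ / 2) (by positivity)).and (hω ρ' (δ / 2) (by positivity))).exists
    have h3 := abs_sub (A n ω - m ρ') (A n ω - m ρ)
    rw [sub_sub_sub_cancel_left] at h3
    linarith
  have hc : CauchySeq m := by
    refine Metric.cauchySeq_iff.2 fun δ hδ => ?_
    obtain ⟨ρ₀, hρ₀⟩ := eventually_atTop.1 (hη.eventually_lt_const (half_pos hδ))
    refine ⟨ρ₀, fun ρ hρ ρ' hρ' => ?_⟩
    rw [Real.dist_eq]
    linarith [hm ρ ρ', hρ₀ ρ hρ, hρ₀ ρ' hρ']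
  obtain ⟨s, hs⟩ := cauchySeq_tendsto_of_complete hc
  refine ⟨s, ?_⟩
  filter_upwards [h] with ω hω
  refine Metric.tendsto_nhds.2 fun δ hδ => ?_
  obtain ⟨ρ, h1, h2⟩ := ((hη.eventually_lt_const (by positivity : 0 < δ / 4)).and
    (Metric.tendsto_nhds.1 hs (δ / 4) (by positivity))).exists
  filter_upwards [hω ρ (δ / 4) (by positivity)] with n hn
  rw [Real.dist_eq] at h2 ⊢
  have h3 := abs_add_le (A n ω - m ρ) (m ρ - s)
  rw [sub_add_sub_cancel] at h3
  linarith

end Averages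

end PerturbedGrid

/-! ### Locality on the perturbed grid. -/

namespace PerturbedGrid

open MeasureTheory ProbabilityTheory Filter

section Local

variable {d : ℕ} {ε C c : ℝ} {k kA kB : EuclideanSpace ℝ (Fin d) → ℝ}

/-- The matrix `R⁻¹ A R⁻¹ B` built from three kernels on a perturbed grid. -/
noncomputable def sandwichMatrix {ι : Type*} [Fintype ι] [DecidableEq ι]
    (k kA kB : EuclideanSpace ℝ (Fin d) → ℝ) (ε : ℝ) (z : ι → EuclideanSpace ℝ (Fin d))
    (u : ι → Fin d → ℤ) : Matrix ι ι ℝ :=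
  (gridMatrix k ε z u)⁻¹ * gridMatrix kA ε z u * (gridMatrix k ε z u)⁻¹ * gridMatrix kB ε z u

/-- The centre of the lattice cube. -/
def boxCentre (d ρ : ℕ) : latticeBox d ρ :=
  ⟨0, by simp [Pi.le_def]⟩

lemma measurable_mul_apply {α ι : Type*} [MeasurableSpace α] [Fintype ι] {M N : α → Matrix ι ι ℝ}
    (hM : ∀ i j, Measurable fun a => M a i j) (hN : ∀ i j, Measurable fun a => N a i j) (i j : ι) :
    Measurable fun a => (M a * N a) i j := by
  simp only [Matrix.mul_apply]
  exact Finset.measurable_fun_sum _ fun l _ => (hM i l).mul (hN l j)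

lemma measurable_sandwichMatrix_apply {ι : Type*} [Fintype ι] [DecidableEq ι] (hk : Continuous k)
    (hA : Continuous kA) (hB : Continuous kB) (ε : ℝ) (u : ι → Fin d → ℤ) (i j : ι) :
    Measurable fun z : ι → EuclideanSpace ℝ (Fin d) => sandwichMatrix k kA kB ε z u i j := by
  have hc : ∀ {k : EuclideanSpace ℝ (Fin d) → ℝ}, Continuous k →
      ∀ i j, Measurable fun z : ι → EuclideanSpace ℝ (Fin d) => gridMatrix k ε z u i j :=
    fun hk i j => (continuous_gridMatrix_apply hk ε u i j).measurable
  have hinv : ∀ i j, Measurable fun z : ι → EuclideanSpace ℝ (Fin d) =>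
      (gridMatrix k ε z u)⁻¹ i j := by
    intro i j
    have hcm : Continuous fun z : ι → EuclideanSpace ℝ (Fin d) => gridMatrix k ε z u :=
      continuous_matrix fun i j => continuous_gridMatrix_apply hk ε u i j
    -- Inverse determinant times adjugate is measurable in `z`, even across singular configurations.
    simp only [Matrix.inv_def, Matrix.smul_apply, Ring.inverse_eq_inv', smul_eq_mul]
    exact hcm.matrix_det.measurable.inv.mul (hcm.matrix_adjugate.matrix_elem i j).measurable
  exact measurable_mul_apply (measurable_mul_apply (measurable_mul_apply hinv (hc hA)) hinv)
    (hc hB) i j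

lemma abs_sandwichMatrix_apply_le (hε₀ : 0 ≤ ε) (hε : ε < 1 / 2) (hC : 0 ≤ C) (hc : 0 < c)
    (hA : ∀ t, |kA t| ≤ C / (1 + ‖t‖ ^ (d + 1))) (hB : ∀ t, |kB t| ≤ C / (1 + ‖t‖ ^ (d + 1)))
    {ι : Type} [Fintype ι] [DecidableEq ι] {u : ι → Fin d → ℤ} (hu : u.Injective)
    {z : ι → EuclideanSpace ℝ (Fin d)} (hz : z ∈ cubeConfig d)
    (hco : IsCoercive c (gridMatrix k ε z u)) (i : ι) :
    |sandwichMatrix k kA kB ε z u i i| ≤ (c⁻¹ * ∑' w, latticeMajorant d ε C w) ^ 2 :=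
  abs_inv_mul_mul_inv_mul_le (latticeMajorant_nonneg hε hC) (summable_latticeMajorant hε hC) hu hc
    hco (abs_gridMatrix_le hε₀ hε hA u hz) (abs_gridMatrix_le hε₀ hε hB u hz) i

/-- The inclusion of the cube about `v i` into the first `n` sites. -/
noncomputable def boxEmbedding {v : ℕ → Fin d → ℤ} (hinj : v.Injective) {ρ n i : ℕ} (hi : i < n)
    (hb : i ∉ boundaryIndices v ρ n) (w : latticeBox d ρ) : Fin n :=
  ⟨neighbourIndex v ρ i w, neighbourIndex_lt hinj hi hb w⟩

section Embedding

variable {v : ℕ → Fin d → ℤ} (hinj : v.Injective) {ρ n i : ℕ} (hi : i < n)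
  (hb : i ∉ boundaryIndices v ρ n)

lemma boxEmbedding_injective : (boxEmbedding hinj hi hb).Injective := fun _ _ h =>
  neighbourIndex_injective (mem_interiorIndices_of_notMem hi hb) (congrArg Fin.val h)

lemma boxEmbedding_centre : boxEmbedding hinj hi hb (boxCentre d ρ) = ⟨i, hi⟩ :=
  Fin.ext (neighbourIndex_zero hinj (mem_interiorIndices_of_notMem hi hb) _ rfl)

lemma apply_boxEmbedding (w : latticeBox d ρ) : v (boxEmbedding hinj hi hb w) = v i + w :=
  mem_interiorIndices_of_notMem hi hb w

lemma gridMatrix_submatrix_boxEmbedding (k : EuclideanSpace ℝ (Fin d) → ℝ) (ε : ℝ)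
    (x : ℕ → EuclideanSpace ℝ (Fin d)) :
    (gridMatrix k ε (fun j : Fin n => x j) fun j => v j).submatrix (boxEmbedding hinj hi hb)
      (boxEmbedding hinj hi hb) =
      gridMatrix k ε (fun w : latticeBox d ρ => x (neighbourIndex v ρ i w)) Subtype.val := by
  rw [gridMatrix_submatrix, ← gridMatrix_translate k ε
    (fun w : latticeBox d ρ => x (neighbourIndex v ρ i w)) Subtype.val (v i)]
  congr 1
  funext w
  exact apply_boxEmbedding hinj hi hb w

include hinj hb in
/-- The diagonal entries of `R⁻¹ A R⁻¹ B` depend, up to a small error, on a cube only. -/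
lemma abs_sandwichMatrix_sub_le (hε₀ : 0 ≤ ε) (hε : ε < 1 / 2) (hC : 0 ≤ C) (hc : 0 < c)
    (hk : ∀ t, |k t| ≤ C / (1 + ‖t‖ ^ (d + 1)))
    (hA : ∀ t, |kA t| ≤ C / (1 + ‖t‖ ^ (d + 1))) (hB : ∀ t, |kB t| ≤ C / (1 + ‖t‖ ^ (d + 1)))
    {x : ℕ → EuclideanSpace ℝ (Fin d)} (hx : x ∈ cubeConfig d)
    (hco : IsCoercive c (gridMatrix k ε (fun j : Fin n => x j) fun j => v j)) (hρ : 0 < ρ) :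
    |sandwichMatrix k kA kB ε (fun j : Fin n => x j) (fun j => v j) ⟨i, hi⟩ ⟨i, hi⟩ -
      sandwichMatrix k kA kB ε (fun w : latticeBox d ρ => x (neighbourIndex v ρ i w)) Subtype.val
        (boxCentre d ρ) (boxCentre d ρ)| ≤
      (∑' w, latticeMajorant d ε C w) * (1 + c⁻¹ * (∑' w, latticeMajorant d ε C w)) *
        (c⁻¹ * c⁻¹ * (c⁻¹ * ∑' w, latticeMajorant d ε C w) +
          c⁻¹ * (c⁻¹ * (1 + c⁻¹ * ∑' w, latticeMajorant d ε C w))) *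
        commModulus (latticeMajorant d ε C) ρ := by
  have hz : (fun j : Fin n => x j) ∈ cubeConfig d := fun j => hx j
  have h := abs_inv_mul_mul_inv_mul_sub_le (k := boxCentre d ρ) (ρ := (ρ : ℝ))
    (latticeMajorant_nonneg hε hC) (summable_latticeMajorant hε hC)
    (u := fun j : Fin n => v j) (fun a b h => Fin.ext (hinj h)) (by exact_mod_cast hρ) hc
    (boxEmbedding_injective hinj hi hb) (fun j hj => ?_) hco (abs_gridMatrix_le hε₀ hε hk _ hz)
    (abs_gridMatrix_le hε₀ hε hA _ hz) (abs_gridMatrix_le hε₀ hε hB _ hz)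
  · simp only [gridMatrix_submatrix_boxEmbedding, boxEmbedding_centre] at h
    exact h
  · rw [boxEmbedding_centre] at hj
    -- Integer vectors carry the sup norm, so the ball of radius `ρ` is the cube.
    have hmem : v j - v i ∈ latticeBox d ρ := by
      have h1 : ∀ k, |(v j - v i) k| ≤ (ρ : ℤ) := fun k => by
        have h2 := (norm_le_pi_norm (v j - v i) k).trans hj
        rw [Int.norm_eq_abs] at h2
        exact_mod_cast h2
      rw [Finset.mem_Icc]
      exact ⟨fun k => (abs_le.1 (h1 k)).1, fun k => (abs_le.1 (h1 k)).2⟩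
    refine ⟨⟨v j - v i, hmem⟩, Fin.ext (hinj ?_)⟩
    exact (apply_boxEmbedding hinj hi hb _).trans (add_sub_cancel (v i) (v j))

end Embedding

end Local

/-! ### Almost sure limits and lower bounds. -/

section Limit

variable {d : ℕ} {v : ℕ → Fin d → ℤ} {ε C c : ℝ} {k kA kB : EuclideanSpace ℝ (Fin d) → ℝ}
  {Ω : Type*} [MeasurableSpace Ω] {P : Measure Ω} [IsProbabilityMeasure P]
  {L : Measure (EuclideanSpace ℝ (Fin d))} {X : ℕ → Ω → EuclideanSpace ℝ (Fin d)}

/-- The law of large numbers for a local function at the sites of the grid. -/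
lemma ae_tendsto_average_local (hinj : v.Injective) (hX : iIndepFun X P)
    (hXm : ∀ i, Measurable (X i)) (hXL : ∀ i, P.map (X i) = L)
    (hXc : ∀ ω, (fun i => X i ω) ∈ cubeConfig d) {ρ : ℕ}
    {ψ : (latticeBox d ρ → EuclideanSpace ℝ (Fin d)) → ℝ} (hψ : Measurable ψ) {B : ℝ}
    (hB : ∀ z ∈ cubeConfig d, |ψ z| ≤ B) :
    ∀ᵐ ω ∂P, Tendsto (fun n : ℕ => (∑ i ∈ Finset.range n, (interiorIndices v ρ).indicator
      (fun i => (ψ fun w => X (neighbourIndex v ρ i w) ω) -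
        ∫ a, ψ a ∂(Measure.pi fun _ => L)) i) / n) atTop (nhds 0) :=
  ae_tendsto_average_pattern hX hXm hXL hψ (neighbourIndex v ρ) (interiorIndices v ρ)
    (fun _ hi => neighbourIndex_injective hi) (C := B)
    (fun _ _ ω => hB _ fun _ => hXc ω _) (overlapIndices v ρ)
    (card_overlapIndices_le v ρ) fun _ hi _ hj => neighbourIndex_ne hinj hi hj

/-- Off the boundary, diagonal entries are within `η ρ` of a bounded function of one cube, whose
averages obey the law of large numbers; `exists_limit_of_approx` then removes the radius. -/
theorem exists_ae_tendsto_trace (hd : 0 < d) (hv : IsGridEnumeration v) (hε₀ : 0 ≤ ε)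
    (hε : ε < 1 / 2) (hC : 0 ≤ C) (hc : 0 < c) (hkc : Continuous k) (hAc : Continuous kA)
    (hBc : Continuous kB) (hk : ∀ t, |k t| ≤ C / (1 + ‖t‖ ^ (d + 1)))
    (hA : ∀ t, |kA t| ≤ C / (1 + ‖t‖ ^ (d + 1))) (hB : ∀ t, |kB t| ≤ C / (1 + ‖t‖ ^ (d + 1)))
    (hco : ∀ {ι : Type} [Fintype ι] (u : ι → Fin d → ℤ), u.Injective →
      ∀ z ∈ cubeConfig (α := ι) d, IsCoercive c (gridMatrix k ε z u))
    (hX : iIndepFun X P) (hXm : ∀ i, Measurable (X i)) (hXL : ∀ i, P.map (X i) = L)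
    (hXc : ∀ ω, (fun i => X i ω) ∈ cubeConfig d) :
    ∃ s, ∀ᵐ ω ∂P, Tendsto (fun n : ℕ => (sandwichMatrix k kA kB ε (fun j : Fin n => X j ω)
      (fun j => v j)).trace / n) atTop (nhds s) := by
  have hinj := hv.injective hd
  set W := ∑' w, latticeMajorant d ε C w
  set b := (c⁻¹ * W) ^ 2
  -- The error of `abs_sandwichMatrix_sub_le` at radius `ρ + 1`; the shift keeps the cut-off scale
  -- positive.
  set η : ℕ → ℝ := fun ρ => W * (1 + c⁻¹ * W) *
    (c⁻¹ * c⁻¹ * (c⁻¹ * W) + c⁻¹ * (c⁻¹ * (1 + c⁻¹ * W))) *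
      commModulus (latticeMajorant d ε C) ((ρ + 1 : ℕ) : ℝ)
  have hη : Tendsto η atTop (nhds 0) := by
    have h1 := (tendsto_commModulus (latticeMajorant_nonneg hε hC)
      (summable_latticeMajorant (d := d) hε hC)).comp
      (tendsto_natCast_atTop_atTop.comp (tendsto_add_atTop_nat 1))
    have h2 := h1.const_mul (W * (1 + c⁻¹ * W) *
      (c⁻¹ * c⁻¹ * (c⁻¹ * W) + c⁻¹ * (c⁻¹ * (1 + c⁻¹ * W))))
    rw [mul_zero] at h2
    exact h2
  have hW : 0 ≤ W := tsum_nonneg (latticeMajorant_nonneg hε hC)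
  have hη0 : ∀ ρ, 0 ≤ η ρ := fun ρ => by
    have : 0 ≤ commModulus (latticeMajorant d ε C) ((ρ + 1 : ℕ) : ℝ) :=
      tsum_nonneg fun w => mul_nonneg (latticeMajorant_nonneg hε hC w)
        (le_min zero_le_one (by positivity))
    positivity
  let ψ : ∀ ρ : ℕ, (latticeBox d ρ → EuclideanSpace ℝ (Fin d)) → ℝ := fun ρ z =>
    sandwichMatrix k kA kB ε z Subtype.val (boxCentre d ρ) (boxCentre d ρ)
  have hψm : ∀ ρ, Measurable (ψ ρ) := fun ρ =>
    measurable_sandwichMatrix_apply hkc hAc hBc ε _ _ _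
  have hψb : ∀ ρ, ∀ z ∈ cubeConfig d, |ψ ρ z| ≤ b := fun ρ z hz =>
    abs_sandwichMatrix_apply_le hε₀ hε hC hc hA hB Subtype.val_injective hz
      (hco _ Subtype.val_injective z hz) _
  refine exists_limit_of_approx (η := η)
    (m := fun ρ => ∫ a, ψ (ρ + 1) a ∂(Measure.pi fun _ => L)) hη ?_
  have hlln := ae_all_iff.2 fun ρ : ℕ =>
    ae_tendsto_average_local (v := v) hinj hX hXm hXL hXc (hψm (ρ + 1)) (hψb (ρ + 1))
  filter_upwards [hlln] with ω hω ρ δ hδ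
  set m := ∫ a, ψ (ρ + 1) a ∂(Measure.pi fun _ => L)
  let T : ∀ n : ℕ, Matrix (Fin n) (Fin n) ℝ := fun n =>
    sandwichMatrix k kA kB ε (fun j : Fin n => X j ω) (fun j => v j)
  have hz : ∀ n : ℕ, (fun j : Fin n => X j ω) ∈ cubeConfig d := fun n j => hXc ω j
  have hcoT : ∀ n : ℕ, IsCoercive c (gridMatrix k ε (fun j : Fin n => X j ω) fun j => v j) :=
    fun n => hco _ (fun a b h => Fin.ext (hinj h)) _ (hz n)
  have h := eventually_abs_average_sub_le
    (t := fun n i => if h : i < n then T n ⟨i, h⟩ ⟨i, h⟩ else 0)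
    (m := m) (η := η ρ) (B := 2 * b + |m|)
    (hv.tendsto_card_boundaryIndices hd (ρ + 1)) (hη0 ρ) (hω ρ) (fun n i hi hb => ?_)
    (fun n i hi => ?_) hδ
  · filter_upwards [h] with n hn
    rw [Finset.sum_range] at hn
    simpa [Matrix.trace] using hn
  · rw [Set.indicator_of_mem (mem_interiorIndices_of_notMem hi hb), dif_pos hi,
      sub_sub_sub_cancel_right]
    have h1 := abs_sandwichMatrix_sub_le hinj hi hb hε₀ hε hC hc hk hA hB (x := fun i => X i ω)
      (hXc ω) (hcoT n) (Nat.succ_pos ρ)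
    simp only [W, η, T, ψ]
    exact h1
  · rw [dif_pos hi]
    have h1 : |T n ⟨i, hi⟩ ⟨i, hi⟩| ≤ b := by
      exact abs_sandwichMatrix_apply_le hε₀ hε hC hc hA hB (fun a b h => Fin.ext (hinj h))
        (hz n) (hcoT n) _
    by_cases hg : i ∈ interiorIndices v (ρ + 1)
    · rw [Set.indicator_of_mem hg, sub_sub_sub_cancel_right]
      have h2 : |ψ (ρ + 1) fun w => X (neighbourIndex v (ρ + 1) i w) ω| ≤ b :=
        hψb _ _ fun w => hXc ω _
      linarith [abs_sub (T n ⟨i, hi⟩ ⟨i, hi⟩)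
          (ψ (ρ + 1) fun w => X (neighbourIndex v (ρ + 1) i w) ω),
        abs_nonneg m]
    · rw [Set.indicator_of_notMem hg, sub_zero]
      linarith [abs_sub (T n ⟨i, hi⟩ ⟨i, hi⟩) m, abs_nonneg (T n ⟨i, hi⟩ ⟨i, hi⟩)]

/-- The open set where `ψ` is nonzero contains a product of neighbourhoods of support points, each
of positive mass. -/
lemma integral_pi_pos_of_mem_support [IsProbabilityMeasure L] {κ : Type*} [Fintype κ]
    {ψ : (κ → EuclideanSpace ℝ (Fin d)) → ℝ} (hψ : Continuous ψ) (h0 : ∀ z, 0 ≤ ψ z)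
    (hi : Integrable ψ (Measure.pi fun _ => L)) {a : κ → EuclideanSpace ℝ (Fin d)}
    (ha : ∀ w, a w ∈ L.support) (hne : ψ a ≠ 0) : 0 < ∫ z, ψ z ∂(Measure.pi fun _ => L) := by
  rw [integral_pos_iff_support_of_nonneg h0 hi]
  obtain ⟨u, hu, hsub⟩ := isOpen_pi_iff'.1 (hψ.isOpen_support) a hne
  refine lt_of_lt_of_le ?_ (measure_mono hsub)
  rw [Measure.pi_pi]
  exact pos_iff_ne_zero.2 (Finset.prod_ne_zero_iff.2 fun w _ =>
    (((Measure.mem_support_iff_forall _).1 (ha w)) _ ((hu w).1.mem_nhds (hu w).2)).ne')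

/-- The normalised squared Hilbert–Schmidt norm of the matrix of a kernel that does not vanish
at all admissible lags stays away from zero. -/
theorem exists_ae_eventually_le_sum_sq [IsProbabilityMeasure L] (hd : 0 < d)
    (hv : IsGridEnumeration v)
    (hkc : Continuous k) (hk : ∀ t, |k t| ≤ C)
    (hX : iIndepFun X P) (hXm : ∀ i, Measurable (X i)) (hXL : ∀ i, P.map (X i) = L)
    (hXc : ∀ ω, (fun i => X i ω) ∈ cubeConfig d) {w : Fin d → ℤ}
    {t₁ t₂ : EuclideanSpace ℝ (Fin d)} (h₁ : t₁ ∈ L.support) (h₂ : t₂ ∈ L.support)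
    (hw : w = 0 → t₁ = t₂) (hne : k (latticePoint w + ε • (t₁ - t₂)) ≠ 0) :
    ∃ m, 0 < m ∧ ∀ᵐ ω ∂P, ∀ᶠ n : ℕ in atTop, m ≤ (∑ i, ∑ j,
      gridMatrix k ε (fun j : Fin n => X j ω) (fun j => v j) i j ^ 2) / n := by
  have hinj := hv.injective hd
  have hC : 0 ≤ C := (abs_nonneg _).trans (hk 0)
  set ρ := Finset.univ.sup fun k => (w k).natAbs
  have hρ : ∀ k, (w k).natAbs ≤ ρ := fun k =>
    Finset.le_sup (f := fun k => (w k).natAbs) (Finset.mem_univ k)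
  -- The lag from the site at `-w` to the centre is `0 - (-w) = w`.
  have hwmem : -w ∈ latticeBox d ρ := by
    rw [Finset.mem_Icc]
    exact ⟨fun k => by have := hρ k; simp only [Pi.neg_apply]; omega,
      fun k => by have := hρ k; simp only [Pi.neg_apply]; omega⟩
  let w' : latticeBox d ρ := ⟨-w, hwmem⟩
  let ψ : (latticeBox d ρ → EuclideanSpace ℝ (Fin d)) → ℝ := fun z =>
    gridMatrix k ε z Subtype.val (boxCentre d ρ) w' ^ 2
  have hψc : Continuous ψ := (continuous_gridMatrix_apply hkc ε _ _ _).pow 2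
  have hψb : ∀ z, |ψ z| ≤ C ^ 2 := fun z => by
    rw [abs_pow]; exact pow_le_pow_left₀ (abs_nonneg _) (hk _) 2
  have hψ0 : ∀ z, 0 ≤ ψ z := fun z => sq_nonneg _
  have hm : 0 < ∫ z, ψ z ∂(Measure.pi fun _ => L) := by
    classical
    -- The witness puts `t₁` at the centre and `t₂` elsewhere. When `w = 0` both sites coincide,
    -- which is why `hw` then asks for `t₁ = t₂`.
    refine integral_pi_pos_of_mem_support hψc hψ0 (Integrable.of_bound
      hψc.measurable.aestronglyMeasurable (C ^ 2) (ae_of_all _ hψb))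
      (a := fun u => if u = boxCentre d ρ then t₁ else t₂) (fun u => ?_) ?_
    · split_ifs
      · exact h₁
      · exact h₂
    · refine pow_ne_zero 2 ?_
      have h3 : (if w' = boxCentre d ρ then t₁ else t₂) = t₂ := by
        split_ifs with h
        · exact hw (by simpa [w', boxCentre] using h)
        · rfl
      simp only [gridMatrix, Matrix.of_apply, if_true, h3, latticePoint_sub]
      simpa [w', boxCentre] using hne
  refine ⟨(∫ z, ψ z ∂(Measure.pi fun _ => L)) / 2, half_pos hm, ?_⟩
  filter_upwards [ae_tendsto_average_local (v := v) hinj hX hXm hXL hXc hψc.measurable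
    fun z _ => hψb z] with ω hω
  set m := ∫ z, ψ z ∂(Measure.pi fun _ => L)
  let A : ∀ n : ℕ, Matrix (Fin n) (Fin n) ℝ := fun n =>
    gridMatrix k ε (fun j : Fin n => X j ω) (fun j => v j)
  have h := eventually_le_average
    (t := fun n i => if h : i < n then ∑ j, A n ⟨i, h⟩ j ^ 2 else 0) (m := m) (B := |m| + C ^ 2)
    (hv.tendsto_card_boundaryIndices hd ρ) hω (fun n i => ?_) (fun n i hi hb => ?_) (fun i => ?_)
    (half_pos hm)
  · filter_upwards [h] with n hn
    rw [Finset.sum_range] at hn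
    simp only [Fin.is_lt, dif_pos, Fin.eta] at hn
    linarith
  · split_ifs
    · exact Finset.sum_nonneg fun j _ => sq_nonneg _
    · exact le_rfl
  · rw [Set.indicator_of_mem (mem_interiorIndices_of_notMem hi hb), dif_pos hi, add_sub_cancel]
    -- Of each row only the entry at the chosen neighbour is kept.
    refine le_trans (le_of_eq ?_) (Finset.single_le_sum (f := fun j => A n ⟨i, hi⟩ j ^ 2)
      (fun j _ => sq_nonneg _) (Finset.mem_univ (boxEmbedding hinj hi hb w')))
    have h1 := congrFun₂ (gridMatrix_submatrix_boxEmbedding hinj hi hb k ε fun i => X i ω)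
      (boxCentre d ρ) w'
    rw [Matrix.submatrix_apply, boxEmbedding_centre] at h1
    simp only [ψ, A]
    rw [← h1]
  · by_cases hg : i ∈ interiorIndices v ρ
    · rw [Set.indicator_of_mem hg, add_sub_cancel]
      exact (hψb _).trans (le_add_of_nonneg_left (abs_nonneg m))
    · rw [Set.indicator_of_notMem hg, add_zero]
      exact le_add_of_nonneg_right (sq_nonneg C)

end Limit

end PerturbedGrid

/-! ### The limit matrix and the main theorem. -/

namespace PerturbedGrid

open MeasureTheory ProbabilityTheory Filter

lemma gridMatrix_sum {d : ℕ} {ι α : Type*} (s : Finset α) (lam : α → ℝ)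
    (k : α → EuclideanSpace ℝ (Fin d) → ℝ) (ε : ℝ) (z : ι → EuclideanSpace ℝ (Fin d))
    (u : ι → Fin d → ℤ) :
    gridMatrix (fun t => ∑ i ∈ s, lam i * k i t) ε z u =
      ∑ i ∈ s, lam i • gridMatrix (k i) ε z u := by
  ext a b
  simp [gridMatrix, Matrix.sum_apply]

lemma trace_sandwichMatrix_comm {d : ℕ} {ι : Type*} [Fintype ι] [DecidableEq ι]
    (k kA kB : EuclideanSpace ℝ (Fin d) → ℝ) (ε : ℝ) (z : ι → EuclideanSpace ℝ (Fin d))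
    (u : ι → Fin d → ℤ) :
    (sandwichMatrix k kA kB ε z u).trace = (sandwichMatrix k kB kA ε z u).trace := by
  unfold sandwichMatrix
  rw [Matrix.mul_assoc (_ * _) _ (gridMatrix kB ε z u), Matrix.trace_mul_comm, ← Matrix.mul_assoc]

/-- Bilinearity turns the quadratic form at `lam` into one trace, that of the directional
derivative. -/
lemma trace_sandwichMatrix_sum {d p : ℕ} {ι : Type*} [Fintype ι] [DecidableEq ι]
    (k : EuclideanSpace ℝ (Fin d) → ℝ) (kD : Fin p → EuclideanSpace ℝ (Fin d) → ℝ)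
    (lam : Fin p → ℝ) (ε : ℝ) (z : ι → EuclideanSpace ℝ (Fin d)) (u : ι → Fin d → ℤ) :
    (sandwichMatrix k (fun t => ∑ i, lam i * kD i t) (fun t => ∑ i, lam i * kD i t) ε z u).trace =
      ∑ i, ∑ j, lam i * lam j * (sandwichMatrix k (kD i) (kD j) ε z u).trace := by
  simp only [sandwichMatrix, gridMatrix_sum, Matrix.sum_mul, Matrix.trace_sum,
    Matrix.mul_smul, Matrix.smul_mul, Matrix.trace_smul, smul_eq_mul, Finset.mul_sum]
  rw [Finset.sum_comm]
  exact Finset.sum_congr rfl fun i _ => Finset.sum_congr rfl fun j _ => by ring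

/-- Perturbations with law `L` agree almost surely with measurable ones that stay in the cube. -/
lemma exists_measurable_cube_version {d : ℕ} {Ω : Type*} [MeasurableSpace Ω] {P : Measure Ω}
    {L : Measure (EuclideanSpace ℝ (Fin d))} (hL : IsPerturbationLaw L)
    {X : ℕ → Ω → EuclideanSpace ℝ (Fin d)} (hXL : ∀ i, HasLaw (X i) L P) :
    ∃ Y : ℕ → Ω → EuclideanSpace ℝ (Fin d), (∀ i, Measurable (Y i)) ∧ (∀ i, X i =ᵐ[P] Y i) ∧
      ∀ ω, (fun i => Y i ω) ∈ cubeConfig d := by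
  let Q : Set (EuclideanSpace ℝ (Fin d)) := {x | ∀ k, |x k| ≤ 1}
  have hQ : MeasurableSet Q := by
    have : Q = ⋂ k, {x : EuclideanSpace ℝ (Fin d) | |x k| ≤ 1} := by ext x; simp [Q]
    rw [this]
    exact MeasurableSet.iInter fun k => measurableSet_le (by fun_prop) measurable_const
  have hQL : ∀ᵐ x ∂L, x ∈ Q := by
    filter_upwards [Measure.support_mem_ae (μ := L)] with x hx k
    exact abs_le.2 (hL.support_subset x hx k)
  -- Values outside the cube, a null event, are sent to the origin, which lies in the cube.
  refine ⟨fun i => Q.indicator id ∘ (hXL i).aemeasurable.mk (X i),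
    fun i => (measurable_id.indicator hQ).comp (hXL i).aemeasurable.measurable_mk, fun i => ?_,
    fun ω i k => ?_⟩
  · rw [← (hXL i).map_eq] at hQL
    filter_upwards [ae_of_ae_map (hXL i).aemeasurable hQL, (hXL i).aemeasurable.ae_eq_mk]
      with ω h1 h2
    rw [Function.comp, ← h2, Set.indicator_of_mem h1, id]
  · simp only [Function.comp]
    by_cases h : (hXL i).aemeasurable.mk (X i) ω ∈ Q
    · rw [Set.indicator_of_mem h]; exact h k
    · rw [Set.indicator_of_notMem h]; simp

/-- Existence and positive definiteness of the limit, when every direction is detected by some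
lag of the perturbed grid. -/
theorem exists_isSigmaML_posDef {d p : ℕ} (hd : 0 < d) {a b : ℝ}
    {K : (Fin p → ℝ) → EuclideanSpace ℝ (Fin d) → ℝ} (hK : IsRegularModel (paramBox p a b) K)
    {θ₀ : Fin p → ℝ} (hθ₀ : ∀ i, a < θ₀ i ∧ θ₀ i < b) {v : ℕ → Fin d → ℤ}
    (hv : IsGridEnumeration v) {ε : ℝ} (hε₀ : 0 ≤ ε) (hε : ε < 1 / 2)
    {L : Measure (EuclideanSpace ℝ (Fin d))} (hL : IsPerturbationLaw L)
    {Ω : Type*} [MeasurableSpace Ω] {P : Measure Ω} [IsProbabilityMeasure P]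
    {X : ℕ → Ω → EuclideanSpace ℝ (Fin d)} (hX : iIndepFun X P) (hXL : ∀ i, HasLaw (X i) L P)
    (hdet : ∀ lam : Fin p → ℝ, lam ≠ 0 → ∃ w : Fin d → ℤ, ∃ t₁ ∈ L.support, ∃ t₂ ∈ L.support,
      (w = 0 → t₁ = t₂) ∧
      dirDeriv (paramBox p a b) K θ₀ lam (latticePoint w + ε • (t₁ - t₂)) ≠ 0) :
    ∃ S : Matrix (Fin p) (Fin p) ℝ, IsSigmaML (paramBox p a b) K v ε P X θ₀ S ∧ S.PosDef := by
  have := hL.prob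
  set Θ := paramBox p a b
  have hθ : θ₀ ∈ Θ := mem_of_mem_nhds (paramBox_mem_nhds hθ₀)
  have hinj := hv.injective hd
  obtain ⟨Y, hYm, hXY, hYc⟩ := exists_measurable_cube_version hL hXL
  have hY : iIndepFun Y P := hX.congr hXY
  have hYL : ∀ i, P.map (Y i) = L := fun i => by
    rw [← Measure.map_congr (hXY i)]; exact (hXL i).map_eq
  obtain ⟨C, hC, hkC, hDC⟩ := hK.exists_decay hθ
  obtain ⟨c, hc, hco⟩ := hK.exists_isCoercive hθ hε₀ hε
  let kD : Fin p → EuclideanSpace ℝ (Fin d) → ℝ := fun i t =>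
    partialWithin Θ i (fun θ => K θ t) θ₀
  let T : Fin p → Fin p → ℕ → Ω → ℝ := fun i j n ω =>
    (sandwichMatrix (K θ₀) (kD i) (kD j) ε (fun l : Fin n => Y l ω) (fun l => v l)).trace / n
  choose s hs using fun i j => exists_ae_tendsto_trace hd hv hε₀ hε hC hc (hK.continuous hθ)
    (hK.continuous_partialWithin hθ₀ i) (hK.continuous_partialWithin hθ₀ j) hkC (hDC i) (hDC j)
    hco hY hYm hYL hYc
  have hlim : ∀ᵐ ω ∂P, ∀ i j, Tendsto (fun n => T i j n ω) atTop (nhds (s i j)) :=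
    ae_all_iff.2 fun i => ae_all_iff.2 fun j => hs i j
  refine ⟨Matrix.of fun i j => s i j / 2, fun i j => ?_, ?_⟩
  · filter_upwards [hlim, ae_all_iff.2 hXY] with ω h1 h2
    have h3 : (fun n : ℕ => (1 / (n : ℝ)) * (matrixML Θ K v ε (fun m => X m ω) n θ₀ i j).trace) =
        fun n => T i j n ω / 2 := by
      funext n
      have h4 : (fun m => X m ω) = fun m => Y m ω := funext h2
      have h5 : matrixML Θ K v ε (fun m => X m ω) n θ₀ i j = (1 / 2 : ℝ) •
          sandwichMatrix (K θ₀) (kD i) (kD j) ε (fun l : Fin n => Y l ω) (fun l => v l) := by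
        rw [h4]; rfl
      rw [h5, Matrix.trace_smul, smul_eq_mul]
      simp only [T]
      ring
    rw [h3]
    exact (h1 i j).div_const 2
  · obtain ⟨ω₀, hω₀⟩ := hlim.exists
    refine Matrix.PosDef.of_dotProduct_mulVec_pos ?_ fun lam hlam => ?_
    · ext i j
      have h1 : s j i = s i j := tendsto_nhds_unique (hω₀ j i)
        ((hω₀ i j).congr fun n => by simp only [T]; rw [trace_sandwichMatrix_comm])
      simp [h1]
    obtain ⟨w, t₁, ht₁, t₂, ht₂, hw, hne⟩ := hdet lam hlam
    have hbound : ∃ C', ∀ t, |dirDeriv Θ K θ₀ lam t| ≤ C' := by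
      refine ⟨∑ i, |lam i| * C, fun t => (Finset.abs_sum_le_sum_abs _ _).trans
        (Finset.sum_le_sum fun i _ => ?_)⟩
      rw [abs_mul]
      refine mul_le_mul_of_nonneg_left ((hDC i t).trans (div_le_self hC ?_)) (abs_nonneg _)
      linarith [pow_nonneg (norm_nonneg t) (d + 1)]
    obtain ⟨C', hC'⟩ := hbound
    obtain ⟨m, hm, hsum⟩ := exists_ae_eventually_le_sum_sq hd hv (hK.continuous_dirDeriv hθ₀ lam)
      hC' hY hYm hYL hYc ht₁ ht₂ hw hne
    -- The limits are deterministic, so one outcome suffices.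
    obtain ⟨ω, h1, h2⟩ := (hlim.and hsum).exists
    -- Adding one makes the norm bound strictly positive.
    set W := (∑' w, latticeMajorant d ε C w) + 1
    have hW : 0 < W := by
      have : 0 ≤ ∑' w, latticeMajorant d ε C w := tsum_nonneg (latticeMajorant_nonneg hε hC)
      positivity
    have hq : Tendsto (fun n => ∑ i, ∑ j, lam i * lam j * T i j n ω) atTop
        (nhds (∑ i, ∑ j, lam i * lam j * s i j)) :=
      tendsto_finsetSum _ fun i _ => tendsto_finsetSum _ fun j _ => (h1 i j).const_mul _
    have hlow : (c / W ^ 2) ^ 2 * m ≤ ∑ i, ∑ j, lam i * lam j * s i j := by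
      refine ge_of_tendsto hq ?_
      filter_upwards [h2] with n hn
      have hz : (fun l : Fin n => Y l ω) ∈ cubeConfig d := fun l => hYc ω l
      have hu : Function.Injective fun l : Fin n => v l := fun a b h => Fin.ext (hinj h)
      have hR := hco _ hu _ hz
      have hsymm : (gridMatrix (dirDeriv Θ K θ₀ lam) ε (fun l : Fin n => Y l ω)
          fun l => v l).transpose = gridMatrix (dirDeriv Θ K θ₀ lam) ε (fun l : Fin n => Y l ω)
          fun l => v l := by
        ext i j
        simp only [gridMatrix, Matrix.transpose_apply, Matrix.of_apply, dirDeriv]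
        refine Finset.sum_congr rfl fun l _ => ?_
        rw [← hK.partialWithin_neg hθ]
        congr 3
        funext θ
        congr 1
        simp only [smul_sub]; abel
      have h3 := le_trace_inv_mul_mul_inv_mul hc hW hR (fun x => ?_) hsymm
      · have h4 := trace_sandwichMatrix_sum (K θ₀) kD lam ε (fun l : Fin n => Y l ω) fun l => v l
        have h5 : ∑ i, ∑ j, lam i * lam j * T i j n ω = (sandwichMatrix (K θ₀)
            (fun t => ∑ i, lam i * kD i t) (fun t => ∑ i, lam i * kD i t) ε
            (fun l : Fin n => Y l ω) fun l => v l).trace / n := by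
          rw [h4, Finset.sum_div]
          refine Finset.sum_congr rfl fun i _ => ?_
          rw [Finset.sum_div]
          exact Finset.sum_congr rfl fun j _ => (mul_div_assoc _ _ _).symm
        rw [h5]
        refine (mul_le_mul_of_nonneg_left hn (sq_nonneg _)).trans ?_
        rw [← mul_div_assoc]
        exact div_le_div_of_nonneg_right h3 (Nat.cast_nonneg n)
      · refine (l2norm_mulVec_le_tsum (latticeMajorant_nonneg hε hC)
          (summable_latticeMajorant hε hC) hu (abs_gridMatrix_le hε₀ hε hkC _ hz) x).trans ?_
        exact mul_le_mul_of_nonneg_right (le_add_of_nonneg_right zero_le_one) (l2norm_nonneg x)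
    have hpos : 0 < (c / W ^ 2) ^ 2 * m := by positivity
    have heq : star lam ⬝ᵥ (Matrix.of fun i j => s i j / 2).mulVec lam =
        (∑ i, ∑ j, lam i * lam j * s i j) / 2 := by
      simp only [star_trivial, dotProduct, Matrix.mulVec, Matrix.of_apply, Finset.mul_sum,
        Finset.sum_div]
      exact Finset.sum_congr rfl fun i _ => Finset.sum_congr rfl fun j _ => by ring
    rw [heq]
    linarith

end PerturbedGrid

theorem mainTheorem6 {d p : ℕ} (hd : 0 < d) (θinf θsup : ℝ)
    (K : (Fin p → ℝ) → EuclideanSpace ℝ (Fin d) → ℝ)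
    (hK : PerturbedGrid.IsRegularModel (PerturbedGrid.paramBox p θinf θsup) K)
    (θ₀ : Fin p → ℝ) (hθ₀ : ∀ i, θinf < θ₀ i ∧ θ₀ i < θsup)
    (v : ℕ → Fin d → ℤ) (hv : PerturbedGrid.IsGridEnumeration v)
    (ε : ℝ) (hε₀ : 0 ≤ ε) (hε : ε < 1 / 2)
    (L : MeasureTheory.Measure (EuclideanSpace ℝ (Fin d))) (hL : PerturbedGrid.IsPerturbationLaw L)
    {Ω : Type*} [MeasurableSpace Ω] (P : MeasureTheory.Measure Ω)
    [MeasureTheory.IsProbabilityMeasure P] (X : ℕ → Ω → EuclideanSpace ℝ (Fin d))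
    (hX : ProbabilityTheory.iIndepFun X P) (hXL : ∀ i, ProbabilityTheory.HasLaw (X i) L P) :
    (ε = 0 →
      (¬ ∃ lam : Fin p → ℝ, lam ≠ 0 ∧ ∀ w : Fin d → ℤ,
        PerturbedGrid.dirDeriv (PerturbedGrid.paramBox p θinf θsup) K θ₀ lam
          (PerturbedGrid.latticePoint w) = 0) →
      ∃ S : Matrix (Fin p) (Fin p) ℝ,
        PerturbedGrid.IsSigmaML (PerturbedGrid.paramBox p θinf θsup) K v ε P X θ₀ S ∧ S.PosDef) ∧
    (ε ≠ 0 →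
      (¬ ∃ lam : Fin p → ℝ, lam ≠ 0 ∧
        (∀ᵐ t ∂(MeasureTheory.volume.restrict (PerturbedGrid.lagSet L.support ε)),
          PerturbedGrid.dirDeriv (PerturbedGrid.paramBox p θinf θsup) K θ₀ lam t = 0) ∧
        PerturbedGrid.dirDeriv (PerturbedGrid.paramBox p θinf θsup) K θ₀ lam 0 = 0) →
      ∃ S : Matrix (Fin p) (Fin p) ℝ,
        PerturbedGrid.IsSigmaML (PerturbedGrid.paramBox p θinf θsup) K v ε P X θ₀ S ∧ S.PosDef) := by
  have := hL.prob
  obtain ⟨s₀, hs₀⟩ := MeasureTheory.Measure.nonempty_support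
    (MeasureTheory.IsProbabilityMeasure.ne_zero L)
  refine ⟨fun _ h => PerturbedGrid.exists_isSigmaML_posDef hd hK hθ₀ hv hε₀ hε hL hX hXL
    fun lam hlam => ?_, fun _ h =>
    PerturbedGrid.exists_isSigmaML_posDef hd hK hθ₀ hv hε₀ hε hL hX hXL fun lam hlam => ?_⟩
  · by_contra hcon
    push Not at hcon
    refine h ⟨lam, hlam, fun w => ?_⟩
    -- Equal support points cancel and leave the bare lattice lag.
    simpa using hcon w s₀ hs₀ s₀ hs₀ fun _ => rfl
  · by_contra hcon
    push Not at hcon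
    refine h ⟨lam, hlam, ?_, ?_⟩
    · have hmeas : MeasurableSet
          {t | PerturbedGrid.dirDeriv (PerturbedGrid.paramBox p θinf θsup) K θ₀ lam t = 0} :=
        (isClosed_singleton.preimage (hK.continuous_dirDeriv hθ₀ lam)).measurableSet
      rw [MeasureTheory.ae_restrict_iff hmeas]
      -- An undetected direction vanishes at every point of the lag set, which is more than almost
      -- everywhere.
      refine MeasureTheory.ae_of_all _ fun t => ?_
      rintro ⟨w, hw, t₁, h₁, t₂, h₂, rfl⟩
      exact hcon w t₁ h₁ t₂ h₂ fun hw' => absurd hw' hw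
    · have h1 := hcon 0 s₀ hs₀ s₀ hs₀ fun _ => rfl
      have h2 : PerturbedGrid.latticePoint (0 : Fin d → ℤ) = 0 := by
        ext k; simp [PerturbedGrid.latticePoint]
      simpa [h2] using h1
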